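/- An orthogonal polygon is a bounded region of the plane (a nonempty connected open set that is the interior of its closure, taken together with its boundary; holes are allowed) whose boundary consists of finitely many axis-parallel line segments. A finite family of orthogonal polygons has an orthogonal dissection to another one if the members of the first family can be cut into finitely many orthogonal polygons (with pairwise disjoint interiors in each member) which, after a translation of each, without rotation or reflection, form the members of the second family, again with pairwise disjoint interiors. The orthogonal Dehn invariant of an orthogonal polygon $P$ is the element $\mathcal{D}(P)=\sum_i h_i\otimes w_i$ of $\mathbb{R}\otimes_{\mathbb{Q}}\mathbb{R}$, where $P$ is subdivided in any way into finitely many axis-parallel rectangles with heights $h_i$ and widths $w_i$; it does not depend on the subdivision. Its rank is the least $r$ such that $\mathcal{D}(P)$ is a sum of $r$ pure tensors $x\otimes y$. An orthogonal polygon $T$ (a prototile) tiles the plane periodically if the plane is covered by translates of $T$ with pairwise disjoint interiors, such that the tiling is invariant under the translations by two linearly independent vectors. Theorem. Let $P$ be an orthogonal polygon and let $n\ge 1$ be an integer. Then $n$ copies of $P$ have an orthogonal dissection to a single orthogonal polygon that tiles the plane periodically if and only if the rank of the orthogonal Dehn invariant $\mathcal{D}(P)$ is at most two. -/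

import Mathlib

open scoped TensorProduct

/-- The translate of the planar set `A` by the vector `v`. -/
def planeTranslate (v : ℝ × ℝ) (A : Set (ℝ × ℝ)) : Set (ℝ × ℝ) :=
  (fun x => v + x) '' A

/-- A segment in the plane that is horizontal or vertical. -/
def IsAxisParallelSegment (σ : Set (ℝ × ℝ)) : Prop :=
  ∃ p q : ℝ × ℝ, (p.1 = q.1 ∨ p.2 = q.2) ∧ σ = segment ℝ p q

/-- An orthogonal polygon, as a closed set: a bounded region (the closure of a nonempty connected
open set, which is its interior) whose boundary consists of finitely many axis-parallel segments.
Holes are allowed. -/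
structure IsOrthogonalPolygon (P : Set (ℝ × ℝ)) : Prop where
  bounded : Bornology.IsBounded P
  regular : closure (interior P) = P
  connected : IsConnected (interior P)
  boundary : ∃ s : Set (Set (ℝ × ℝ)), s.Finite ∧ (∀ σ ∈ s, IsAxisParallelSegment σ) ∧
    frontier P = ⋃₀ s

/-- The family `piece` subdivides `A`: its members cover exactly `A` and have pairwise disjoint
interiors. -/
def Subdivides {ι : Type*} (piece : ι → Set (ℝ × ℝ)) (A : Set (ℝ × ℝ)) : Prop :=
  (⋃ i, piece i) = A ∧
    Pairwise (fun i j => Disjoint (interior (piece i)) (interior (piece j)))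

/-- The family of polygons `A` has an orthogonal dissection to the family of polygons `B`: there
are finitely many orthogonal polygons (the pieces), of which the `k`-th one is cut out of the
member `a k` of `A` and is translated by `v k` into the member `b k` of `B`, such that the pieces
subdivide every member of `A` and their translates subdivide every member of `B`. -/
def HasOrthogonalDissection {α β : Type*} (A : α → Set (ℝ × ℝ)) (B : β → Set (ℝ × ℝ)) : Prop :=
  ∃ (m : ℕ) (piece : Fin m → Set (ℝ × ℝ)) (a : Fin m → α) (b : Fin m → β) (v : Fin m → ℝ × ℝ),
    (∀ k, IsOrthogonalPolygon (piece k)) ∧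
    (∀ i, Subdivides (fun k : {k : Fin m // a k = i} => piece k) (A i)) ∧
    (∀ j, Subdivides (fun k : {k : Fin m // b k = j} => planeTranslate (v k) (piece k)) (B j))

/-- `T` tiles the plane periodically by translation: some set `S` of translation vectors gives
translates of `T` that cover the plane with pairwise disjoint interiors, and this tiling is mapped
to itself by the translations along two linearly independent vectors. -/
def TilesPlanePeriodically (T : Set (ℝ × ℝ)) : Prop :=
  ∃ S : Set (ℝ × ℝ),
    Subdivides (fun s : S => planeTranslate s T) Set.univ ∧
    ∃ u v : ℝ × ℝ, LinearIndependent ℝ ![u, v] ∧ planeTranslate u S = S ∧ planeTranslate v S = S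

/-- `D` is the sum of `h ⊗ w` over the rectangles, of height `h` and width `w`, of some subdivision
of `P` into finitely many axis-parallel rectangles `[l, r] × [b, t]`. -/
def IsDehnValue (P : Set (ℝ × ℝ)) (D : ℝ ⊗[ℚ] ℝ) : Prop :=
  ∃ (m : ℕ) (l r b t : Fin m → ℝ), (∀ i, l i < r i) ∧ (∀ i, b i < t i) ∧
    Subdivides (fun i => Set.Icc (l i) (r i) ×ˢ Set.Icc (b i) (t i)) P ∧
    D = ∑ i, (t i - b i) ⊗ₜ[ℚ] (r i - l i)

open Classical in
/-- The orthogonal Dehn invariant of `P`, in the tensor product of rational vector spaces `ℝ ⊗ ℝ`,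
computed from any subdivision of `P` into rectangles (every orthogonal polygon has one, and all of
them give the same value). It is set to `0` if there is none. -/
noncomputable def dehnInvariant (P : Set (ℝ × ℝ)) : ℝ ⊗[ℚ] ℝ :=
  if h : ∃ D, IsDehnValue P D then h.choose else 0

/-- The rank of a tensor: the least number of terms in an expression of it as a sum of pure
tensors. -/
noncomputable def tensorRank (D : ℝ ⊗[ℚ] ℝ) : ℕ :=
  sInf {r : ℕ | ∃ x y : Fin r → ℝ, D = ∑ i, x i ⊗ₜ[ℚ] y i}

/-! The bridge between the two sides is the L-shape formed by an `a × d` and a `c × b` rectangle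
(width times height), with invariant `d ⊗ a + b ⊗ c`. For positive sides with `c ≤ a` it is a
fundamental region of the lattice spanned by `(a, -b)` and `(c, d)` (`isFundamentalRegion_lRegion`).

Necessity. Let `T` be a prototile of a tiling invariant under a lattice. That lattice contains a
sublattice spanned by vectors `(a, -b)` and `(c, d)` as above (`exists_lRegion_basis`). Cutting
tiles along the translates of the L-shape and moving the parts back by lattice vectors reassembles
`k` tiles into one L-shape, so `k • D(T)` is a sum of two pure tensors
(`exists_dehn_fundamentalRegion_eq_nsmul`). A dissection gives `D(T) = n • D(P)`, and dividing by `k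
* n` over `ℚ` keeps two terms.

Sufficiency. The image of `D(P)` under multiplication is the area, which is positive; this allows a
sum of two pure tensors to be rewritten with all four factors positive (`exists_pos_decomposition`).
Hence `n • D(P)` is the invariant of an L-shape, and that shape tiles. Equal invariants give a
dissection (`hasOrthogonalDissection_of_sum_eq`): all sides are sums of members of one
`ℚ`-independent positive family `e`, so both families split into `e i × e j` cells. Independence of
the tensors `e i ⊗ e j` makes the number of cells of each kind agree.

Additivity of the invariant is proved for half-open sets, where subdivisions are exact partitions.
`QuadrantStable` transfers it to closed polygons, which overlap along boundaries. -/

/-! ### Well-definedness of the Dehn invariant on half-open sets. -/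

/-- A vanishing step function has no jump, so at each point the coefficients of intervals ending
there balance those of intervals starting there. Grouping the sum by endpoints then cancels it. Only
additivity in the length is needed, so `B` may be a tensor product as well as a multiplication. -/
theorem sum_bilin_eq_zero_of_step_sum_eq_zero {ι W Z : Type*} [AddCommGroup W] [Module ℚ W]
    [AddCommGroup Z] [Module ℚ Z] (B : ℝ →ₗ[ℚ] W →ₗ[ℚ] Z) (s : Finset ι) (l r : ι → ℝ)
    (hlr : ∀ i ∈ s, l i ≤ r i) (c : ι → W)
    (hz : ∀ x, ∑ i ∈ s, (if l i ≤ x ∧ x < r i then c i else 0) = 0) :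
    ∑ i ∈ s, B (r i - l i) (c i) = 0 := by
  classical
  have key : ∀ p : ℝ, ∑ i ∈ s, (if r i = p then c i else 0)
      = ∑ i ∈ s, (if l i = p then c i else 0) := by
    intro p
    -- For `x` just left of `p`, the value at `x` minus the value at `p` isolates the endpoints
    -- equal to `p`.
    have hev : ∀ᶠ x in nhdsWithin p (Set.Iio p), ∀ i ∈ s,
        (l i ≤ x ↔ l i < p) ∧ (x < r i ↔ p ≤ r i) := by
      rw [Filter.eventually_all_finset]
      intro i _
      have h0 : ∀ᶠ x in nhdsWithin p (Set.Iio p), x < p := eventually_mem_nhdsWithin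
      have h1 : ∀ᶠ x in nhdsWithin p (Set.Iio p), l i < p → l i < x := by
        by_cases h : l i < p
        · filter_upwards [nhdsWithin_le_nhds (lt_mem_nhds h)] with x hx _ using hx
        · exact Filter.Eventually.of_forall fun x hx => absurd hx h
      have h2 : ∀ᶠ x in nhdsWithin p (Set.Iio p), r i < p → r i < x := by
        by_cases h : r i < p
        · filter_upwards [nhdsWithin_le_nhds (lt_mem_nhds h)] with x hx _ using hx
        · exact Filter.Eventually.of_forall fun x hx => absurd hx h
      filter_upwards [h0, h1, h2] with x h0 h1 h2
      refine ⟨⟨fun h => lt_of_le_of_lt h h0, fun h => (h1 h).le⟩, fun h => ?_, fun h => h0.trans_le h⟩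
      by_contra h'
      exact absurd (h2 (not_le.1 h')) (not_lt.2 h.le)
    obtain ⟨x, hx⟩ := hev.exists
    have e1 := hz p
    have e2 := hz x
    rw [← sub_eq_zero, ← Finset.sum_sub_distrib]
    have : ∑ i ∈ s, ((if r i = p then c i else 0) - (if l i = p then c i else 0)) =
        ∑ i ∈ s, ((if l i ≤ x ∧ x < r i then c i else 0)
          - (if l i ≤ p ∧ p < r i then c i else 0)) := by
      refine Finset.sum_congr rfl fun i hi => ?_
      simp only [(hx i hi).1, (hx i hi).2]
      have := hlr i hi
      rcases lt_trichotomy (l i) p with h | h | h <;>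
        rcases lt_trichotomy (r i) p with h' | h' | h' <;>
        first
        | (exfalso; linarith)
        | simp [h, h', h.le, h'.le, h.ne, h'.ne, h.ne', h'.ne', h.not_ge, h'.not_ge, h.not_gt,
            h'.not_gt]
        | simp [h, h', h.le, h.ne]
        | simp [h, h', h'.le, h'.ne']
        | simp [h, h']
    rw [this, Finset.sum_sub_distrib, e1, e2, sub_zero]
  have expand : ∀ g : ι → ℝ, ∀ U : Finset ℝ, (∀ i ∈ s, g i ∈ U) →
      ∑ i ∈ s, B (g i) (c i) = ∑ p ∈ U, B p (∑ i ∈ s, if g i = p then c i else 0) := by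
    intro g U hU
    simp_rw [map_sum]
    rw [Finset.sum_comm]
    refine Finset.sum_congr rfl fun i hi => ?_
    rw [Finset.sum_eq_single_of_mem (g i) (hU i hi)]
    · simp
    · intro p _ hp
      rw [if_neg (Ne.symm hp), map_zero]
  simp_rw [map_sub, LinearMap.sub_apply]
  rw [Finset.sum_sub_distrib, expand r (s.image r ∪ s.image l), expand l (s.image r ∪ s.image l)]
  · simp_rw [key, sub_self]
  · exact fun i hi => Finset.mem_union_right _ (Finset.mem_image_of_mem _ hi)
  · exact fun i hi => Finset.mem_union_left _ (Finset.mem_image_of_mem _ hi)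

/-- The half-open rectangle `[l, r) × [b, t)`. -/
def hoRect (l r b t : ℝ) : Set (ℝ × ℝ) := Set.Ico l r ×ˢ Set.Ico b t

theorem mem_hoRect {l r b t : ℝ} {z : ℝ × ℝ} :
    z ∈ hoRect l r b t ↔ (l ≤ z.1 ∧ z.1 < r) ∧ (b ≤ z.2 ∧ z.2 < t) := Iff.rfl

open Classical in
theorem indicator_hoRect {l r b t : ℝ} {z : ℝ × ℝ} :
    (hoRect l r b t).indicator (1 : ℝ × ℝ → ℤ) z =
      if (l ≤ z.1 ∧ z.1 < r) ∧ (b ≤ z.2 ∧ z.2 < t) then 1 else 0 := by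
  rw [Set.indicator_apply]; congr 1

/-- The graph of the Dehn invariant, on the integral combinations of indicator functions of
half-open rectangles. -/
noncomputable def dehnGraph : AddSubgroup ((ℝ × ℝ → ℤ) × (ℝ ⊗[ℚ] ℝ)) :=
  AddSubgroup.closure {x | ∃ l r b t : ℝ, l ≤ r ∧ b ≤ t ∧
    x = ((hoRect l r b t).indicator 1, (t - b) ⊗ₜ[ℚ] (r - l))}

theorem hoRect_mem_dehnGraph {l r b t : ℝ} (h : l ≤ r) (h' : b ≤ t) :
    ((hoRect l r b t).indicator 1, (t - b) ⊗ₜ[ℚ] (r - l)) ∈ dehnGraph :=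
  AddSubgroup.subset_closure ⟨l, r, b, t, h, h', rfl⟩

theorem exists_rep_of_mem_dehnGraph {x : (ℝ × ℝ → ℤ) × (ℝ ⊗[ℚ] ℝ)} (hx : x ∈ dehnGraph) :
    ∃ (ι : Type) (_ : Fintype ι) (n : ι → ℤ) (l r b t : ι → ℝ),
      (∀ i, l i ≤ r i) ∧ (∀ i, b i ≤ t i) ∧
      (∀ z, x.1 z = ∑ i, n i * (hoRect (l i) (r i) (b i) (t i)).indicator 1 z) ∧
      x.2 = ∑ i, n i • ((t i - b i) ⊗ₜ[ℚ] (r i - l i)) := by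
  unfold dehnGraph at hx
  induction hx using AddSubgroup.closure_induction with
  | mem x h =>
    obtain ⟨l, r, b, t, h1, h2, rfl⟩ := h
    exact ⟨Unit, inferInstance, fun _ => 1, fun _ => l, fun _ => r, fun _ => b, fun _ => t,
      fun _ => h1, fun _ => h2, by simp, by simp⟩
  | zero => exact ⟨Empty, inferInstance, Empty.elim, Empty.elim, Empty.elim, Empty.elim, Empty.elim,
      by simp, by simp, by simp, by simp⟩
  | add x y _ _ hx hy =>
    obtain ⟨ι, _, n, l, r, b, t, h1, h2, h3, h4⟩ := hx
    obtain ⟨κ, _, n', l', r', b', t', h1', h2', h3', h4'⟩ := hy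
    refine ⟨ι ⊕ κ, inferInstance, Sum.elim n n', Sum.elim l l', Sum.elim r r', Sum.elim b b',
      Sum.elim t t', ?_, ?_, ?_, ?_⟩
    · rintro (i | i) <;> simp [h1, h1']
    · rintro (i | i) <;> simp [h2, h2']
    · intro z; simp [h3, h3']
    · simp [h4, h4']
  | neg x _ hx =>
    obtain ⟨ι, _, n, l, r, b, t, h1, h2, h3, h4⟩ := hx
    refine ⟨ι, inferInstance, -n, l, r, b, t, h1, h2, ?_, ?_⟩
    · intro z; simp [h3]
    · simp [h4]

/-- Fubini for step functions: integrating out `x` with ordinary multiplication leaves a vanishing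
step function of `y`, whose coefficients are signed widths. The one-variable lemma applies to it
again, now with the tensor product. -/
theorem eq_zero_of_zero_mem_dehnGraph {d : ℝ ⊗[ℚ] ℝ} (h : ((0 : ℝ × ℝ → ℤ), d) ∈ dehnGraph) :
    d = 0 := by
  obtain ⟨ι, _, n, l, r, b, t, h1, h2, h3, h4⟩ := exists_rep_of_mem_dehnGraph h
  have slice : ∀ y, ∑ i, (if b i ≤ y ∧ y < t i then (n i : ℝ) * (r i - l i) else 0) = 0 := by
    intro y
    have := sum_bilin_eq_zero_of_step_sum_eq_zero (LinearMap.mul ℚ ℝ) Finset.univ l r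
      (fun i _ => h1 i) (fun i => if b i ≤ y ∧ y < t i then (n i : ℝ) else 0) (by
        intro x
        have := congrArg (Int.cast : ℤ → ℝ) (h3 (x, y))
        simp only [Pi.zero_apply, Int.cast_zero, Int.cast_sum, Int.cast_mul] at this
        refine Eq.trans ?_ this.symm
        refine Finset.sum_congr rfl fun i _ => ?_
        by_cases hx : l i ≤ x ∧ x < r i <;> by_cases hy : b i ≤ y ∧ y < t i <;>
          simp [indicator_hoRect, hx, hy])
    refine Eq.trans (Finset.sum_congr rfl fun i _ => ?_) this
    rw [LinearMap.mul_apply']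
    by_cases hy : b i ≤ y ∧ y < t i <;> simp only [hy, if_true, if_false, mul_zero, mul_comm, and_true]
  have := sum_bilin_eq_zero_of_step_sum_eq_zero (TensorProduct.mk ℚ ℝ ℝ) Finset.univ b t
    (fun i _ => h2 i) _ slice
  simp only at h4
  rw [h4, ← this]
  refine Finset.sum_congr rfl fun i _ => ?_
  rw [← zsmul_eq_mul, map_zsmul]
  rfl

theorem dehnGraph_unique {f : ℝ × ℝ → ℤ} {d d' : ℝ ⊗[ℚ] ℝ} (h : (f, d) ∈ dehnGraph)
    (h' : (f, d') ∈ dehnGraph) : d = d' := by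
  have := dehnGraph.sub_mem h h'
  rw [Prod.mk_sub_mk, sub_self] at this
  exact sub_eq_zero.1 (eq_zero_of_zero_mem_dehnGraph this)

theorem dehnGraph_translate {x : (ℝ × ℝ → ℤ) × (ℝ ⊗[ℚ] ℝ)} (h : x ∈ dehnGraph) (v : ℝ × ℝ) :
    ((fun z => x.1 (z - v)), x.2) ∈ dehnGraph := by
  unfold dehnGraph at h
  induction h using AddSubgroup.closure_induction with
  | mem x h =>
    obtain ⟨l, r, b, t, h1, h2, rfl⟩ := h
    have := hoRect_mem_dehnGraph (l := l + v.1) (r := r + v.1) (b := b + v.2) (t := t + v.2)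
      (by linarith) (by linarith)
    convert this using 2
    · ext z
      simp only [indicator_hoRect, Prod.fst_sub, Prod.snd_sub, le_sub_iff_add_le,
        sub_lt_iff_lt_add]
    · simp
  | zero => exact dehnGraph.zero_mem
  | add x y _ _ hx hy => exact dehnGraph.add_mem hx hy
  | neg x _ hx => exact dehnGraph.neg_mem hx

/-- Makes intersections of elementary sets elementary; the value of `d` is immaterial where this is
used. -/
theorem dehnGraph_mul {x y : (ℝ × ℝ → ℤ) × (ℝ ⊗[ℚ] ℝ)} (hx : x ∈ dehnGraph)
    (hy : y ∈ dehnGraph) : ∃ d, (x.1 * y.1, d) ∈ dehnGraph := by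
  unfold dehnGraph at hx
  induction hx using AddSubgroup.closure_induction with
  | mem x h =>
    obtain ⟨l, r, b, t, h1, h2, rfl⟩ := h
    unfold dehnGraph at hy
    induction hy using AddSubgroup.closure_induction with
    | mem y h =>
      obtain ⟨l', r', b', t', h1', h2', rfl⟩ := h
      -- The outer `max` clamps the far corner, so that an empty intersection becomes a degenerate
      -- rectangle.
      refine ⟨(max (max b b') (min t t') - max b b') ⊗ₜ[ℚ] (max (max l l') (min r r') - max l l'), ?_⟩
      convert hoRect_mem_dehnGraph (l := max l l') (r := max (max l l') (min r r'))
        (b := max b b') (t := max (max b b') (min t t')) (le_max_left _ _) (le_max_left _ _) using 2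
      ext z
      rw [Pi.mul_apply]
      simp only [indicator_hoRect]
      rw [mul_ite, mul_one, mul_zero, ← ite_and]
      congr 1
      simp only [lt_max_iff, max_le_iff, lt_min_iff, eq_iff_iff]
      constructor
      · rintro ⟨⟨⟨_, _⟩, _, _⟩, ⟨_, _⟩, _, _⟩
        refine ⟨⟨⟨?_, ?_⟩, Or.inr ⟨?_, ?_⟩⟩, ⟨?_, ?_⟩, Or.inr ⟨?_, ?_⟩⟩ <;> assumption
      · rintro ⟨⟨⟨h1, h2⟩, h3⟩, ⟨h4, h5⟩, h6⟩
        have := h3.resolve_left (by rintro (h | h) <;> linarith)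
        have := h6.resolve_left (by rintro (h | h) <;> linarith)
        tauto
    | zero => exact ⟨0, by rw [Prod.fst_zero, mul_zero]; exact dehnGraph.zero_mem⟩
    | add x y _ _ hx hy =>
      obtain ⟨d, hd⟩ := hx
      obtain ⟨d', hd'⟩ := hy
      exact ⟨d + d', by rw [Prod.fst_add, mul_add]; exact dehnGraph.add_mem hd hd'⟩
    | neg x _ hx =>
      obtain ⟨d, hd⟩ := hx
      exact ⟨-d, by rw [Prod.fst_neg, mul_neg]; exact dehnGraph.neg_mem hd⟩
  | zero => exact ⟨0, by rw [Prod.fst_zero, zero_mul]; exact dehnGraph.zero_mem⟩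
  | add x y _ _ hx hy =>
    obtain ⟨d, hd⟩ := hx
    obtain ⟨d', hd'⟩ := hy
    exact ⟨d + d', by rw [Prod.fst_add, add_mul]; exact dehnGraph.add_mem hd hd'⟩
  | neg x _ hx =>
    obtain ⟨d, hd⟩ := hx
    exact ⟨-d, by rw [Prod.fst_neg, neg_mul]; exact dehnGraph.neg_mem hd⟩

/-! ### Passage between half-open sets and their closures. -/

/-- `f` is constant on a small half-open square with lower left corner at any given point. -/
def RightConstant (f : ℝ × ℝ → ℤ) : Prop :=
  ∀ z : ℝ × ℝ, ∃ ε > 0, ∀ w ∈ hoRect z.1 (z.1 + ε) z.2 (z.2 + ε), f w = f z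

theorem rightConstant_of_mem_dehnGraph {x : (ℝ × ℝ → ℤ) × (ℝ ⊗[ℚ] ℝ)} (hx : x ∈ dehnGraph) :
    RightConstant x.1 := by
  unfold dehnGraph at hx
  induction hx using AddSubgroup.closure_induction with
  | mem x h =>
    obtain ⟨l, r, b, t, h1, h2, rfl⟩ := h
    have one : ∀ (a c x : ℝ), ∃ ε > 0, ∀ w, x ≤ w → w < x + ε → ((a ≤ w ∧ w < c) ↔ (a ≤ x ∧ x < c)) := by
      intro a c x
      rcases lt_or_ge x a with h | h
      · exact ⟨a - x, by linarith, fun w h1 h2 =>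
          ⟨fun h3 => by linarith [h3.1], fun h3 => by linarith [h3.1]⟩⟩
      · rcases lt_or_ge x c with h' | h'
        · exact ⟨c - x, by linarith, fun w h1 h2 =>
            ⟨fun h3 => ⟨h, h'⟩, fun h3 => ⟨by linarith, by linarith⟩⟩⟩
        · exact ⟨1, one_pos, fun w h1 h2 =>
            ⟨fun h3 => by linarith [h3.2], fun h3 => by linarith [h3.2]⟩⟩
    intro z
    obtain ⟨ε, hε, h⟩ := one l r z.1
    obtain ⟨δ, hδ, h'⟩ := one b t z.2
    refine ⟨min ε δ, lt_min hε hδ, fun w hw => ?_⟩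
    obtain ⟨⟨w1, w2⟩, w3, w4⟩ := mem_hoRect.1 hw
    simp only [indicator_hoRect]
    simp only [h w.1 w1 (w2.trans_le (by gcongr; exact min_le_left _ _)),
      h' w.2 w3 (w4.trans_le (by gcongr; exact min_le_right _ _))]
  | zero => exact fun z => ⟨1, one_pos, fun _ _ => rfl⟩
  | add x y _ _ hx hy =>
    intro z
    obtain ⟨ε, hε, h⟩ := hx z
    obtain ⟨δ, hδ, h'⟩ := hy z
    refine ⟨min ε δ, lt_min hε hδ, fun w hw => ?_⟩
    obtain ⟨⟨w1, w2⟩, w3, w4⟩ := mem_hoRect.1 hw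
    have e1 := min_le_left ε δ
    have e2 := min_le_right ε δ
    rw [Prod.fst_add, Pi.add_apply, Pi.add_apply,
      h w ⟨⟨w1, by linarith⟩, w3, by linarith⟩, h' w ⟨⟨w1, by linarith⟩, w3, by linarith⟩]
  | neg x _ hx =>
    intro z
    obtain ⟨ε, hε, h⟩ := hx z
    exact ⟨ε, hε, fun w hw => by rw [Prod.fst_neg, Pi.neg_apply, Pi.neg_apply, h w hw]⟩

open Set Topology Filter

/-- The filter of the open quadrants to the upper right of `z`, near `z`. -/
def quadrantFilter (z : ℝ × ℝ) : Filter (ℝ × ℝ) := 𝓝[Ioi z.1 ×ˢ Ioi z.2] z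

/-- Membership in `E` does not change on going a little to the upper right. -/
def QuadrantStable (E : Set (ℝ × ℝ)) : Prop :=
  ∀ z, ∀ᶠ w in quadrantFilter z, (w ∈ E ↔ z ∈ E)

instance (z : ℝ × ℝ) : (quadrantFilter z).NeBot := by
  unfold quadrantFilter
  rw [nhdsWithin_prod_eq]
  infer_instance

theorem nhds_le_quadrantFilter {z : ℝ × ℝ} {s : Set (ℝ × ℝ)} (h : s ∈ 𝓝 z) :
    ∀ᶠ w in quadrantFilter z, w ∈ s :=
  nhdsWithin_le_nhds h

theorem eventually_interior_quadrantFilter {z : ℝ × ℝ} {E : Set (ℝ × ℝ)}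
    (h : ∀ᶠ w in quadrantFilter z, w ∈ E) : ∀ᶠ w in quadrantFilter z, w ∈ interior E := by
  have ho : IsOpen (Ioi z.1 ×ˢ Ioi z.2) := isOpen_Ioi.prod isOpen_Ioi
  have h1 := eventually_eventually_nhdsWithin.2 h
  have h2 : ∀ᶠ w in quadrantFilter z, w ∈ Ioi z.1 ×ˢ Ioi z.2 := eventually_mem_nhdsWithin
  filter_upwards [h1, h2] with w h1 h2
  rw [ho.nhdsWithin_eq h2] at h1
  exact mem_interior_iff_mem_nhds.2 h1

theorem hoRect_mem_quadrantFilter (z : ℝ × ℝ) {ε : ℝ} (hε : 0 < ε) :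
    hoRect z.1 (z.1 + ε) z.2 (z.2 + ε) ∈ quadrantFilter z := by
  unfold quadrantFilter hoRect
  rw [nhdsWithin_prod_eq]
  refine prod_mem_prod ?_ ?_ <;>
    exact mem_of_superset (Ioo_mem_nhdsGT (by linarith)) Ioo_subset_Ico_self

/-- Membership is decided by the germ of the set to the upper right, where all but finitely many
closed sets can be avoided. This assigns the shared boundary points of closed pieces consistently
and turns subdivisions into partitions. -/
theorem quadrantStable_of_mem_dehnGraph {E : Set (ℝ × ℝ)} {d : ℝ ⊗[ℚ] ℝ}
    (h : (E.indicator 1, d) ∈ dehnGraph) : QuadrantStable E := by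
  intro z
  obtain ⟨ε, hε, hz⟩ := rightConstant_of_mem_dehnGraph h z
  filter_upwards [hoRect_mem_quadrantFilter z hε] with w hw
  have := hz w hw
  simp only at this
  rw [indicator_one_eq_iff] at this
  exact this
where
  indicator_one_eq_iff {E : Set (ℝ × ℝ)} {z w : ℝ × ℝ} :
      E.indicator (1 : ℝ × ℝ → ℤ) z = E.indicator 1 w ↔ (z ∈ E ↔ w ∈ E) := by
    by_cases h : z ∈ E <;> by_cases h' : w ∈ E <;> simp [h, h']

theorem QuadrantStable.eventually_interior {E : Set (ℝ × ℝ)} (h : QuadrantStable E) {z : ℝ × ℝ}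
    (hz : z ∈ E) : ∀ᶠ w in quadrantFilter z, w ∈ interior E := by
  refine eventually_interior_quadrantFilter ?_
  filter_upwards [h z] with w hw using hw.2 hz

theorem QuadrantStable.eventually_notMem_closure {E : Set (ℝ × ℝ)} (h : QuadrantStable E)
    {z : ℝ × ℝ} (hz : z ∉ E) : ∀ᶠ w in quadrantFilter z, w ∉ closure E := by
  have : ∀ᶠ w in quadrantFilter z, w ∈ interior Eᶜ := by
    refine eventually_interior_quadrantFilter ?_
    filter_upwards [h z] with w hw hw' using hz (hw.1 hw')
  filter_upwards [this] with w hw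
  rwa [interior_compl] at hw

theorem QuadrantStable.disjoint_interior_closure {E E' : Set (ℝ × ℝ)} (h' : QuadrantStable E') (hd : Disjoint E E') :
    Disjoint (interior (closure E)) (interior (closure E')) := by
  rw [Set.disjoint_left]
  intro z0 hz hz'
  have hU : IsOpen (interior (closure E) ∩ interior (closure E')) :=
    isOpen_interior.inter isOpen_interior
  obtain ⟨z, hzU, hzE⟩ := mem_closure_iff.1 (interior_subset hz) _ hU ⟨hz, hz'⟩
  obtain ⟨w, hw, hw'⟩ := ((nhds_le_quadrantFilter (hU.mem_nhds hzU)).and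
    (h'.eventually_notMem_closure (Set.disjoint_left.1 hd hzE))).exists
  exact hw' (interior_subset hw.2)

theorem QuadrantStable.disjoint_of_disjoint_interior {E E' : Set (ℝ × ℝ)} (h : QuadrantStable E)
    (h' : QuadrantStable E') (hd : Disjoint (interior (closure E)) (interior (closure E'))) :
    Disjoint E E' := by
  rw [Set.disjoint_left]
  intro z hz hz'
  obtain ⟨w, hw, hw'⟩ := ((h.eventually_interior hz).and (h'.eventually_interior hz')).exists
  exact Set.disjoint_left.1 hd (interior_mono subset_closure hw) (interior_mono subset_closure hw')

theorem exists_mem_of_eventually_mem_closure {ι : Type*} {s : Set ι} (hs : s.Finite)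
    {E : ι → Set (ℝ × ℝ)} (hE : ∀ i ∈ s, QuadrantStable (E i)) {z : ℝ × ℝ}
    (hz : ∀ᶠ w in quadrantFilter z, ∃ i ∈ s, w ∈ closure (E i)) : ∃ i ∈ s, z ∈ E i := by
  by_contra! hc
  have : ∀ᶠ w in quadrantFilter z, ∀ i ∈ s, w ∉ closure (E i) :=
    (hs.eventually_all).2 fun i hi => (hE i hi).eventually_notMem_closure (hc i hi)
  obtain ⟨w, ⟨i, hi, hw⟩, hw'⟩ := (hz.and this).exists
  exact hw' i hi hw

theorem QuadrantStable.subset_of_closure_subset {E E' : Set (ℝ × ℝ)} (h : QuadrantStable E)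
    (h' : QuadrantStable E') (hs : closure E ⊆ closure E') : E ⊆ E' := by
  intro z hz
  by_contra hz'
  obtain ⟨w, hw, hw'⟩ :=
    ((h.eventually_interior hz).and (h'.eventually_notMem_closure hz')).exists
  exact hw' (hs (subset_closure (interior_subset hw)))

theorem indicator_eq_sum_of_partition {ι : Type*} [Fintype ι] {A : Set (ℝ × ℝ)}
    {E : ι → Set (ℝ × ℝ)} (hA : (⋃ i, E i) = A) (hd : Pairwise fun i j => Disjoint (E i) (E j)) :
    A.indicator (1 : ℝ × ℝ → ℤ) = ∑ i, (E i).indicator 1 := by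
  classical
  ext z
  rw [Finset.sum_apply]
  by_cases hz : z ∈ A
  · obtain ⟨i, hi⟩ := mem_iUnion.1 (hA.symm ▸ hz)
    rw [Finset.sum_eq_single i, indicator_of_mem hz, indicator_of_mem hi]
    · intro j _ hj
      exact indicator_of_notMem (fun hj' => Set.disjoint_left.1 (hd hj) hj' hi) _
    · simp
  · rw [indicator_of_notMem hz, Finset.sum_eq_zero]
    intro i _
    exact indicator_of_notMem (fun hi => hz (hA ▸ mem_iUnion.2 ⟨i, hi⟩)) _

theorem sum_mem_dehnGraph_of_partition {ι : Type*} [Fintype ι] {A : Set (ℝ × ℝ)}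
    {E : ι → Set (ℝ × ℝ)} (hA : (⋃ i, E i) = A) (hd : Pairwise fun i j => Disjoint (E i) (E j))
    {d : ι → ℝ ⊗[ℚ] ℝ} (h : ∀ i, ((E i).indicator 1, d i) ∈ dehnGraph) :
    (A.indicator 1, ∑ i, d i) ∈ dehnGraph := by
  have := dehnGraph.sum_mem (t := Finset.univ) fun i _ => h i
  rw [indicator_eq_sum_of_partition hA hd]
  convert this using 1
  exact Prod.ext (by rw [Prod.fst_sum]) (by rw [Prod.snd_sum])

theorem closure_hoRect {l r b t : ℝ} (h : l < r) (h' : b < t) :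
    closure (hoRect l r b t) = Icc l r ×ˢ Icc b t := by
  rw [hoRect, closure_prod_eq, closure_Ico h.ne, closure_Ico h'.ne]

theorem quadrantStable_hoRect {l r b t : ℝ} (h : l ≤ r) (h' : b ≤ t) :
    QuadrantStable (hoRect l r b t) :=
  quadrantStable_of_mem_dehnGraph (hoRect_mem_dehnGraph h h')

theorem QuadrantStable.iUnion {ι : Type*} [Finite ι] {E : ι → Set (ℝ × ℝ)}
    (h : ∀ i, QuadrantStable (E i)) : QuadrantStable (⋃ i, E i) := by
  intro z
  filter_upwards [eventually_all.2 fun i => h i z] with w hw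
  simp [hw]

/-- `E` is a bounded elementary set with Dehn invariant `d` and closure `P`. -/
structure IsElementaryCore (E P : Set (ℝ × ℝ)) (d : ℝ ⊗[ℚ] ℝ) : Prop where
  mem : (E.indicator 1, d) ∈ dehnGraph
  closure_eq : closure E = P
  bounded : Bornology.IsBounded E

theorem IsElementaryCore.stable {E P : Set (ℝ × ℝ)} {d : ℝ ⊗[ℚ] ℝ} (h : IsElementaryCore E P d) :
    QuadrantStable E :=
  quadrantStable_of_mem_dehnGraph h.mem

theorem IsDehnValue.exists_core {P : Set (ℝ × ℝ)} {D : ℝ ⊗[ℚ] ℝ} (h : IsDehnValue P D) :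
    ∃ E, IsElementaryCore E P D := by
  obtain ⟨m, l, r, b, t, hlr, hbt, ⟨hU, hd⟩, rfl⟩ := h
  refine ⟨⋃ i, hoRect (l i) (r i) (b i) (t i), ?_, ?_, ?_⟩
  · refine sum_mem_dehnGraph_of_partition rfl (fun i j hij => ?_)
      fun i => hoRect_mem_dehnGraph (hlr i).le (hbt i).le
    refine (quadrantStable_hoRect (hlr i).le (hbt i).le).disjoint_of_disjoint_interior
      (quadrantStable_hoRect (hlr j).le (hbt j).le) ?_
    rw [closure_hoRect (hlr i) (hbt i), closure_hoRect (hlr j) (hbt j)]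
    exact hd hij
  · rw [closure_iUnion_of_finite, ← hU]
    exact iUnion_congr fun i => closure_hoRect (hlr i) (hbt i)
  · rw [Bornology.isBounded_iUnion]
    exact fun i => (Metric.isBounded_Ico _ _).prod (Metric.isBounded_Ico _ _)

/-! ### Rectangular subdivisions of orthogonal polygons. -/

theorem exists_consecutive_of_notMem {X : Finset ℝ} {x a c : ℝ} (hx : x ∉ X) (ha : a ∈ X) (hc : c ∈ X)
    (hax : a < x) (hxc : x < c) :
    ∃ l ∈ X, ∃ r ∈ X, l < x ∧ x < r ∧ ∀ y ∈ X, y ≤ l ∨ r ≤ y := by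
  classical
  have h1 : (X.filter (· < x)).Nonempty := ⟨a, by simp [ha, hax]⟩
  have h2 : (X.filter (x < ·)).Nonempty := ⟨c, by simp [hc, hxc]⟩
  have e1 := Finset.max'_mem _ h1
  have e2 := Finset.min'_mem _ h2
  rw [Finset.mem_filter] at e1 e2
  refine ⟨_, e1.1, _, e2.1, e1.2, e2.2, fun y hy => ?_⟩
  rcases lt_trichotomy y x with h | h | h
  · exact Or.inl (Finset.le_max' _ _ (by simp [hy, h]))
  · exact absurd (h ▸ hy) hx
  · exact Or.inr (Finset.min'_le _ _ (by simp [hy, h]))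

theorem disjoint_Ioo_of_consecutive {X : Finset ℝ} {l r l' r' : ℝ} (hl : l ∈ X) (hr : r ∈ X)
    (hl' : l' ∈ X) (hr' : r' ∈ X) (h : ∀ y ∈ X, y ≤ l ∨ r ≤ y)
    (h' : ∀ y ∈ X, y ≤ l' ∨ r' ≤ y) {x : ℝ} (hx : x ∈ Ioo l r) (hx' : x ∈ Ioo l' r') :
    l = l' ∧ r = r' := by
  obtain ⟨h1, h2⟩ := hx
  obtain ⟨h3, h4⟩ := hx'
  have e1 := (h l' hl').resolve_right (by linarith)
  have e2 := (h' l hl).resolve_right (by linarith)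
  have e3 := (h r' hr').resolve_left (by linarith)
  have e4 := (h' r hr).resolve_left (by linarith)
  exact ⟨by linarith, by linarith⟩

theorem exists_grid_of_finite_segments {s : Set (Set (ℝ × ℝ))} (hs : s.Finite)
    (h : ∀ σ ∈ s, IsAxisParallelSegment σ) :
    ∃ X : Finset ℝ, ∀ z ∈ ⋃₀ s, z.1 ∈ X ∨ z.2 ∈ X := by
  classical
  choose! p q hpq hσ using h
  refine ⟨hs.toFinset.image (fun σ => (p σ).1) ∪ hs.toFinset.image (fun σ => (p σ).2), ?_⟩
  rintro z ⟨σ, hσs, hz⟩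
  rw [hσ σ hσs, segment_eq_image] at hz
  obtain ⟨θ, _, rfl⟩ := hz
  simp only [Finset.mem_union, Finset.mem_image, Finite.mem_toFinset]
  rcases hpq σ hσs with h | h
  · refine Or.inl (Or.inl ⟨σ, hσs, ?_⟩)
    simp [← h]; ring
  · refine Or.inr (Or.inr ⟨σ, hσs, ?_⟩)
    simp [← h]; ring

/-- Extend the boundary segments to full grid lines. An open grid cell is connected and misses the
boundary, so it lies in the interior or in the complement; the cells of the first kind subdivide
`P`. -/
theorem IsOrthogonalPolygon.exists_isDehnValue {P : Set (ℝ × ℝ)} (hP : IsOrthogonalPolygon P) :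
    ∃ D, IsDehnValue P D := by
  classical
  obtain ⟨s, hs, hseg, hfr⟩ := hP.boundary
  obtain ⟨X0, hX0⟩ := exists_grid_of_finite_segments hs hseg
  rw [← hfr] at hX0
  obtain ⟨M, hM⟩ := hP.bounded.subset_closedBall 0
  have hMb : ∀ z ∈ P, (-(M+1) < z.1 ∧ z.1 < M+1) ∧ (-(M+1) < z.2 ∧ z.2 < M+1) := by
    intro z hz
    have := hM hz
    rw [mem_closedBall_zero_iff, Prod.norm_def, max_le_iff, Real.norm_eq_abs, Real.norm_eq_abs,
      abs_le, abs_le] at this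
    obtain ⟨⟨h1, h2⟩, h3, h4⟩ := this
    refine ⟨⟨?_, ?_⟩, ?_, ?_⟩ <;> linarith
  have hPc : IsClosed P := hP.regular ▸ isClosed_closure
  -- One set serves both coordinates; `±(M+1)` bound the grid strictly outside `P`.
  set X : Finset ℝ := insert (-(M+1)) (insert (M+1) X0) with hX
  have hfX : ∀ z ∈ frontier P, z.1 ∈ X ∨ z.2 ∈ X := fun z hz => by
    rcases hX0 z hz with h | h <;> simp [hX, h]
  let G : Finset ((ℝ × ℝ) × (ℝ × ℝ)) := ((X ×ˢ X) ×ˢ (X ×ˢ X)).filter fun c =>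
    c.1.1 < c.1.2 ∧ c.2.1 < c.2.2 ∧ (∀ y ∈ X, y ≤ c.1.1 ∨ c.1.2 ≤ y) ∧
    (∀ y ∈ X, y ≤ c.2.1 ∨ c.2.2 ≤ y) ∧ Ioo c.1.1 c.1.2 ×ˢ Ioo c.2.1 c.2.2 ⊆ interior P
  have hG : ∀ c, c ∈ G ↔ ((c.1.1 ∈ X ∧ c.1.2 ∈ X) ∧ (c.2.1 ∈ X ∧ c.2.2 ∈ X)) ∧
    c.1.1 < c.1.2 ∧ c.2.1 < c.2.2 ∧ (∀ y ∈ X, y ≤ c.1.1 ∨ c.1.2 ≤ y) ∧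
    (∀ y ∈ X, y ≤ c.2.1 ∨ c.2.2 ≤ y) ∧ Ioo c.1.1 c.1.2 ×ˢ Ioo c.2.1 c.2.2 ⊆ interior P := by
    intro c; simp [G]
  let e := G.equivFin.symm
  refine ⟨_, G.card, fun i => (e i).1.1.1, fun i => (e i).1.1.2, fun i => (e i).1.2.1,
    fun i => (e i).1.2.2, fun i => ((hG _).1 (e i).2).2.1, fun i => ((hG _).1 (e i).2).2.2.1,
    ⟨?_, ?_⟩, rfl⟩
  · apply Subset.antisymm
    · refine iUnion_subset fun i => ?_
      obtain ⟨_, h1, h2, _, _, h3⟩ := (hG _).1 (e i).2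
      have := closure_mono h3
      rwa [closure_prod_eq, closure_Ioo h1.ne, closure_Ioo h2.ne, hP.regular] at this
    · have hcl : IsClosed (⋃ i, Icc (e i).1.1.1 (e i).1.1.2 ×ˢ Icc (e i).1.2.1 (e i).1.2.2) :=
        isClosed_iUnion_of_finite fun i => isClosed_Icc.prod isClosed_Icc
      -- Points off the grid lines are dense, so covering those in the interior suffices: the union
      -- of closed cells is closed.
      have hdense : Dense ((X : Set ℝ)ᶜ ×ˢ (X : Set ℝ)ᶜ) :=
        (X.finite_toSet.countable.dense_compl ℝ).prod (X.finite_toSet.countable.dense_compl ℝ)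
      have h1 := closure_minimal (hdense.open_subset_closure_inter isOpen_interior :
        interior P ⊆ _) isClosed_closure
      rw [hP.regular] at h1
      refine h1.trans (closure_minimal ?_ hcl)
      rintro z ⟨hzP, hz1, hz2⟩
      obtain ⟨⟨a1, a2⟩, a3, a4⟩ := hMb z (interior_subset hzP)
      obtain ⟨l, hl, r, hr, hlx, hxr, hX1⟩ := exists_consecutive_of_notMem (X := X) hz1
        (by simp [hX]) (by simp [hX]) a1 a2
      obtain ⟨b, hb, t, ht, hby, hyt, hX2⟩ := exists_consecutive_of_notMem (X := X) hz2
        (by simp [hX]) (by simp [hX]) a3 a4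
      have hmem : ((l, r), (b, t)) ∈ G := by
        refine (hG _).2 ⟨⟨⟨hl, hr⟩, hb, ht⟩, hlx.trans hxr, hby.trans hyt, hX1, hX2, ?_⟩
        refine IsPreconnected.subset_left_of_subset_union isOpen_interior
          hPc.isOpen_compl (Set.disjoint_left.2 fun w hw hw' => hw' (interior_subset hw)) ?_
          ⟨z, ⟨⟨hlx, hxr⟩, hby, hyt⟩, hzP⟩ (isPreconnected_Ioo.prod isPreconnected_Ioo)
        rintro w ⟨⟨w1, w2⟩, w3, w4⟩
        by_cases hw : w ∈ P
        · left
          by_contra hwi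
          rcases hfX w ⟨subset_closure hw, hwi⟩ with h | h
          · rcases hX1 _ h with h | h
            · exact absurd w1 (not_lt.2 h)
            · exact absurd w2 (not_lt.2 h)
          · rcases hX2 _ h with h | h
            · exact absurd w3 (not_lt.2 h)
            · exact absurd w4 (not_lt.2 h)
        · exact Or.inr hw
      refine mem_iUnion.2 ⟨e.symm ⟨_, hmem⟩, ?_⟩
      simp only [Equiv.apply_symm_apply]
      exact ⟨⟨hlx.le, hxr.le⟩, hby.le, hyt.le⟩
  · intro i j hij
    rw [interior_prod_eq, interior_prod_eq, interior_Icc, interior_Icc, interior_Icc, interior_Icc,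
      Set.disjoint_left]
    rintro z ⟨h1, h2⟩ ⟨h1', h2'⟩
    apply hij
    obtain ⟨⟨⟨g1, g2⟩, g3, g4⟩, _, _, g5, g6, _⟩ := (hG _).1 (e i).2
    obtain ⟨⟨⟨k1, k2⟩, k3, k4⟩, _, _, k5, k6, _⟩ := (hG _).1 (e j).2
    have a := disjoint_Ioo_of_consecutive g1 g2 k1 k2 g5 k5 h1 h1'
    have b := disjoint_Ioo_of_consecutive g3 g4 k3 k4 g6 k6 h2 h2'
    apply e.injective
    exact Subtype.ext (Prod.ext (Prod.ext a.1 a.2) (Prod.ext b.1 b.2))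

theorem dehnInvariant_spec {P : Set (ℝ × ℝ)} (hP : IsOrthogonalPolygon P) :
    IsDehnValue P (dehnInvariant P) := by
  have h := hP.exists_isDehnValue
  rw [dehnInvariant, dif_pos h]
  exact h.choose_spec

/-! ### L-shapes and rectangles are orthogonal polygons. -/

theorem segment_horizontal {a c : ℝ} (h : a ≤ c) (y : ℝ) :
    segment ℝ (a, y) (c, y) = Icc a c ×ˢ {y} := by
  rw [← Prod.image_mk_segment_left, segment_eq_Icc h, prod_singleton]

theorem segment_vertical {b t : ℝ} (h : b ≤ t) (x : ℝ) :
    segment ℝ (x, b) (x, t) = {x} ×ˢ Icc b t := by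
  rw [← Prod.image_mk_segment_right, segment_eq_Icc h, singleton_prod]

/-- The union of two axis-parallel rectangles with the same lower left corner (an L-shape, or a
rectangle) is an orthogonal polygon. -/
theorem isOrthogonalPolygon_L {x₀ x₁ x₂ y₀ y₁ y₂ : ℝ} (hx : x₀ < x₁) (hx' : x₁ ≤ x₂) (hy : y₀ < y₁)
    (hy' : y₁ < y₂) :
    IsOrthogonalPolygon (Icc x₀ x₁ ×ˢ Icc y₀ y₂ ∪ Icc x₀ x₂ ×ˢ Icc y₀ y₁) := by
  set T := Icc x₀ x₁ ×ˢ Icc y₀ y₂ ∪ Icc x₀ x₂ ×ˢ Icc y₀ y₁ with hT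
  set U := Ioo x₀ x₁ ×ˢ Ioo y₀ y₂ ∪ Ioo x₀ x₂ ×ˢ Ioo y₀ y₁ with hU
  have hcl : closure U = T := by
    rw [hU, closure_union, closure_prod_eq, closure_prod_eq, closure_Ioo hx.ne,
      closure_Ioo (hx.trans_le hx').ne, closure_Ioo hy.ne, closure_Ioo (hy.trans hy').ne]
  have hint : interior T = U := by
    apply Subset.antisymm
    · intro z hz
      obtain ⟨ε, hε, hb⟩ := Metric.isOpen_iff.1 isOpen_interior z hz
      -- Small diagonal shifts in both directions stay in `T`, which makes the defining inequalities
      -- strict.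
      have hmem : ∀ η : ℝ, |η| < ε → z + (η, η) ∈ T := fun η hη => by
        refine interior_subset (hb ?_)
        rw [mem_ball_iff_norm, add_sub_cancel_left, Prod.norm_def]
        simpa using hη
      have h1 := hmem (ε / 2) (by rw [abs_of_pos (by linarith)]; linarith)
      have h2 := hmem (-(ε / 2)) (by rw [abs_neg, abs_of_pos (by linarith)]; linarith)
      simp only [hT, mem_union, mem_prod, mem_Icc, Prod.fst_add, Prod.snd_add] at h1 h2
      have h3 : x₀ < z.1 := by rcases h2 with h | h <;> linarith [h.1.1]
      have h4 : y₀ < z.2 := by rcases h2 with h | h <;> linarith [h.2.1]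
      rcases h1 with h | h
      · exact Or.inl ⟨⟨h3, by linarith [h.1.2]⟩, h4, by linarith [h.2.2]⟩
      · exact Or.inr ⟨⟨h3, by linarith [h.1.2]⟩, h4, by linarith [h.2.2]⟩
    · rw [hU, hT]
      exact interior_maximal (union_subset_union
        (prod_mono Ioo_subset_Icc_self Ioo_subset_Icc_self)
        (prod_mono Ioo_subset_Icc_self Ioo_subset_Icc_self))
        ((isOpen_Ioo.prod isOpen_Ioo).union (isOpen_Ioo.prod isOpen_Ioo))
  refine ⟨?_, by rw [hint, hcl], ?_, ?_⟩
  · exact ((Metric.isBounded_Icc _ _).prod (Metric.isBounded_Icc _ _)).union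
      ((Metric.isBounded_Icc _ _).prod (Metric.isBounded_Icc _ _))
  · rw [hint]
    refine ⟨⟨((x₀ + x₁) / 2, (y₀ + y₁) / 2), Or.inl ?_⟩, ?_⟩
    · constructor <;> constructor <;> simp only <;> linarith
    · refine IsPreconnected.union ((x₀ + x₁) / 2, (y₀ + y₁) / 2) ?_ ?_
        (isPreconnected_Ioo.prod isPreconnected_Ioo) (isPreconnected_Ioo.prod isPreconnected_Ioo) <;>
      · constructor <;> constructor <;> simp only <;> linarith
  · refine ⟨{segment ℝ (x₀, y₀) (x₂, y₀), segment ℝ (x₀, y₂) (x₁, y₂), segment ℝ (x₁, y₁) (x₂, y₁),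
      segment ℝ (x₀, y₀) (x₀, y₂), segment ℝ (x₁, y₁) (x₁, y₂), segment ℝ (x₂, y₀) (x₂, y₁)},
      by simp, ?_, ?_⟩
    · intro σ hσ
      simp only [mem_insert_iff, mem_singleton_iff] at hσ
      rcases hσ with rfl | rfl | rfl | rfl | rfl | rfl
      · exact ⟨(x₀, y₀), (x₂, y₀), .inr rfl, rfl⟩
      · exact ⟨(x₀, y₂), (x₁, y₂), .inr rfl, rfl⟩
      · exact ⟨(x₁, y₁), (x₂, y₁), .inr rfl, rfl⟩
      · exact ⟨(x₀, y₀), (x₀, y₂), .inl rfl, rfl⟩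
      · exact ⟨(x₁, y₁), (x₁, y₂), .inl rfl, rfl⟩
      · exact ⟨(x₂, y₀), (x₂, y₁), .inl rfl, rfl⟩
    · rw [frontier, hint, ← hcl, closure_closure, hcl]
      simp only [sUnion_insert, sUnion_singleton]
      rw [segment_horizontal (by linarith), segment_horizontal (by linarith),
        segment_horizontal (by linarith), segment_vertical (by linarith),
        segment_vertical (by linarith), segment_vertical (by linarith)]
      ext z
      simp only [hT, hU, Set.mem_sdiff, mem_union, mem_prod, mem_Icc, mem_Ioo, mem_singleton_iff, not_or,
        not_and, not_lt]
      constructor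
      · rintro ⟨h | h, h1, h2⟩
        · grind
        · grind
      · grind

theorem isOrthogonalPolygon_rect {l r b t : ℝ} (h : l < r) (h' : b < t) :
    IsOrthogonalPolygon (Icc l r ×ˢ Icc b t) := by
  have := isOrthogonalPolygon_L h le_rfl (y₀ := b) (y₁ := (b + t) / 2) (y₂ := t) (by linarith)
    (by linarith)
  rwa [union_eq_left.2 (prod_mono_right (Icc_subset_Icc_right (by linarith)))] at this

/-! ### Common positive generators for finitely many lengths. -/

/-- Given positive `ℚ`-independent reals `e` and a positive number `x` in their span, there are
positive `ℚ`-independent reals `e'` such that `x` and all the `e i` are nonnegative rational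
combinations of the `e' i`. -/
theorem exists_independent_refinement {ι : Type} [Fintype ι] {e : ι → ℝ} (he : ∀ i, 0 < e i)
    (hind : LinearIndependent ℚ e) {n : ι → ℚ} (hx : 0 < ∑ i, n i • e i) :
    ∃ e' : ι → ℝ, (∀ i, 0 < e' i) ∧ LinearIndependent ℚ e' ∧
      (∀ c : ι → ℚ, (∀ i, 0 ≤ c i) → ∃ c' : ι → ℚ, (∀ i, 0 ≤ c' i) ∧
        ∑ i, c i • e i = ∑ i, c' i • e' i) ∧
      ∃ c' : ι → ℚ, (∀ i, 0 ≤ c' i) ∧ ∑ i, n i • e i = ∑ i, c' i • e' i := by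
  classical
  by_cases hneg : ∀ i, 0 ≤ n i
  · exact ⟨e, he, hind, fun c hc => ⟨c, hc, rfl⟩, n, hneg, rfl⟩
  push Not at hneg
  set m : ι → ℚ := fun i => if n i < 0 then -n i else 0 with hm
  set P : ι → ℚ := fun i => if n i < 0 then 0 else n i with hP
  have hm0 : ∀ i, 0 ≤ m i := fun i => by simp only [hm]; split_ifs <;> linarith
  have hP0 : ∀ i, 0 ≤ P i := fun i => by simp only [hP]; split_ifs <;> linarith
  have hnPm : ∀ i, n i = P i - m i := fun i => by simp only [hm, hP]; split_ifs <;> ring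
  set q : ℝ := ∑ i, m i • e i with hq
  set p : ℝ := ∑ i, P i • e i with hp
  have hxpq : ∑ i, n i • e i = p - q := by
    rw [hp, hq, ← Finset.sum_sub_distrib]
    exact Finset.sum_congr rfl fun i _ => by rw [hnPm i, sub_smul]
  have hq0 : 0 < q := by
    obtain ⟨j, hj⟩ := hneg
    refine Finset.sum_pos' (fun i _ => ?_) ⟨j, Finset.mem_univ _, ?_⟩
    · rw [Rat.smul_def]; have := hm0 i; have := he i; positivity
    · rw [Rat.smul_def]
      have : 0 < m j := by simp only [hm, if_pos hj]; linarith
      have := he j; positivity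
  have hpq : q < p := by linarith [hxpq ▸ hx]
  -- Here `x = p - q > 0`. The upper bound keeps `e i - θ i * q` positive; the lower one gives `∑ P
  -- j * θ j ≥ 1`, so that the `-q` in `x` can be absorbed.
  have hθ : ∀ i, ∃ θ : ℚ, e i / p < θ ∧ (θ : ℝ) < e i / q := fun i =>
    exists_rat_btwn (div_lt_div_of_pos_left (he i) hq0 hpq)
  choose θ hθ1 hθ2 using hθ
  have hθ0 : ∀ i, 0 ≤ θ i := fun i => by
    have : (0 : ℝ) < θ i := (div_pos (he i) (hq0.trans hpq)).trans (hθ1 i)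
    exact_mod_cast this.le
  set t : ι → ℚ := fun i => if n i < 0 then 0 else θ i with ht
  have ht0 : ∀ i, 0 ≤ t i := fun i => by
    simp only [ht]; split_ifs
    · exact le_rfl
    · exact hθ0 i
  -- Generators with negative coefficient stay unchanged, so `q` has the same expression in `e'` as
  -- in `e`, and `e i = e' i + t i • q` is a nonnegative combination.
  set e' : ι → ℝ := fun i => e i - t i • q with he'
  have hq' : q = ∑ i, m i • e' i := by
    refine Finset.sum_congr rfl fun i _ => ?_
    simp only [he', ht, hm]
    split_ifs <;> simp
  have hcomb : ∀ c : ι → ℚ, ∑ i, c i • e i = ∑ i, (c i + (∑ j, c j * t j) * m i) • e' i := by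
    intro c
    simp_rw [add_smul, mul_smul]
    rw [Finset.sum_add_distrib, ← Finset.smul_sum, ← hq', Finset.sum_smul, ← Finset.sum_add_distrib]
    refine Finset.sum_congr rfl fun i _ => ?_
    simp only [he', smul_sub, mul_smul]
    ring
  refine ⟨e', ?_, ?_, fun c hc => ⟨_, fun i => ?_, hcomb c⟩, ?_⟩
  · intro i
    simp only [he', ht]
    split_ifs
    · simpa using he i
    · rw [Rat.smul_def, sub_pos]
      exact (lt_div_iff₀ hq0).1 (hθ2 i)
  · rw [Fintype.linearIndependent_iff] at hind ⊢
    intro g hg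
    set G := ∑ i, g i * t i with hG
    have h0 : ∀ i, g i - G * m i = 0 := by
      refine hind _ ?_
      rw [← hg]
      simp_rw [sub_smul, mul_smul, he', smul_sub, Finset.sum_sub_distrib, ← Finset.smul_sum]
      rw [← hq, hG, Finset.sum_smul]
      simp_rw [mul_smul]
    have hG0 : G = 0 := by
      refine Finset.sum_eq_zero fun i _ => ?_
      have := h0 i
      simp only [ht]
      split_ifs with h
      · simp
      · simp only [hm, if_neg h, mul_zero, sub_zero] at this
        rw [this, zero_mul]
    intro i
    simpa [hG0] using h0 i
  · have := Finset.sum_nonneg fun j (_ : j ∈ Finset.univ) => mul_nonneg (hc j) (ht0 j)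
    have := hc i
    have := hm0 i
    positivity
  · refine ⟨fun i => P i + ((∑ j, P j * t j) - 1) * m i, fun i => ?_, ?_⟩
    · have h1 : (1 : ℝ) ≤ ((∑ j, P j * t j : ℚ) : ℝ) := by
        have hp0 : 0 < p := hq0.trans hpq
        rw [← div_self hp0.ne']
        nth_rewrite 1 [hp]
        rw [Finset.sum_div]
        push_cast
        refine Finset.sum_le_sum fun j _ => ?_
        rw [Rat.smul_def, mul_div_assoc]
        simp only [hP, ht]
        split_ifs with h
        · simp
        · have : (0 : ℝ) ≤ n j := by exact_mod_cast not_lt.1 h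
          exact mul_le_mul_of_nonneg_left (hθ1 j).le this
      have h1' : (1 : ℚ) ≤ ∑ j, P j * t j := by exact_mod_cast h1
      have := hP0 i
      have := mul_nonneg (sub_nonneg.2 h1') (hm0 i)
      linarith
    · rw [hxpq, hp, hcomb P]
      nth_rewrite 1 [hq']
      rw [← Finset.sum_sub_distrib]
      refine Finset.sum_congr rfl fun i _ => ?_
      rw [← sub_smul]
      congr 1
      ring

theorem exists_independent_rat_generators (F : Finset ℝ) (hF : ∀ x ∈ F, 0 < x) :
    ∃ (ι : Type) (_ : Fintype ι) (e : ι → ℝ), (∀ i, 0 < e i) ∧ LinearIndependent ℚ e ∧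
      ∀ x ∈ F, ∃ c : ι → ℚ, (∀ i, 0 ≤ c i) ∧ x = ∑ i, c i • e i := by
  classical
  induction F using Finset.induction_on with
  | empty => exact ⟨Empty, inferInstance, Empty.elim, by simp, linearIndependent_empty_type, by simp⟩
  | insert x F _ ih =>
    obtain ⟨ι, _, e, he, hind, hc⟩ := ih fun y hy => hF y (Finset.mem_insert_of_mem hy)
    have hx := hF x (Finset.mem_insert_self _ _)
    by_cases hsp : x ∈ Submodule.span ℚ (range e)
    · obtain ⟨n, rfl⟩ := (Submodule.mem_span_range_iff_exists_fun ℚ).1 hsp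
      obtain ⟨e', he', hind', h1, h2⟩ := exists_independent_refinement he hind hx
      refine ⟨ι, inferInstance, e', he', hind', fun y hy => ?_⟩
      rcases Finset.mem_insert.1 hy with rfl | hy
      · exact h2
      · obtain ⟨c, hc0, rfl⟩ := hc y hy
        exact h1 c hc0
    · refine ⟨Option ι, inferInstance, fun o => o.casesOn' x e, ?_, ?_, fun y hy => ?_⟩
      · rintro (_ | i)
        · exact hx
        · exact he i
      · exact linearIndependent_option'.2 ⟨hind, hsp⟩
      · rcases Finset.mem_insert.1 hy with rfl | hy
        · refine ⟨fun o => o.elim 1 fun _ => 0, ?_, by simp⟩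
          rintro (_ | i) <;> simp
        · obtain ⟨c, hc0, rfl⟩ := hc y hy
          refine ⟨fun o => o.elim 0 c, ?_, by simp⟩
          rintro (_ | i)
          · simp
          · exact hc0 i

theorem exists_sum_of_mem_closure {ι : Type} {e : ι → ℝ} {x : ℝ}
    (h : x ∈ AddSubmonoid.closure (range e)) :
    ∃ (M : ℕ) (τ : Fin M → ι), x = ∑ k, e (τ k) := by
  induction h using AddSubmonoid.closure_induction with
  | mem x h =>
    obtain ⟨i, rfl⟩ := h
    exact ⟨1, fun _ => i, by simp⟩
  | zero => exact ⟨0, Fin.elim0, by simp⟩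
  | add x y _ _ hx hy =>
    obtain ⟨M, τ, rfl⟩ := hx
    obtain ⟨M', τ', rfl⟩ := hy
    exact ⟨M + M', Fin.append τ τ', by simp [Fin.sum_univ_add]⟩

/-- Finitely many positive reals are sums of members of a `ℚ`-independent family of positive
reals. -/
theorem exists_independent_generators (F : Finset ℝ) (hF : ∀ x ∈ F, 0 < x) :
    ∃ (ι : Type) (_ : Fintype ι) (e : ι → ℝ), (∀ i, 0 < e i) ∧ LinearIndependent ℚ e ∧
      ∀ x ∈ F, ∃ (M : ℕ) (τ : Fin M → ι), x = ∑ k, e (τ k) := by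
  classical
  obtain ⟨ι, _, e, he, hind, h⟩ := exists_independent_rat_generators F hF
  choose! c hc0 hc using h
  -- A common denominator: dividing the generators by `N` turns all coefficients into natural
  -- numbers.
  set N : ℕ := ∏ x ∈ F, ∏ i, (c x i).den with hN
  have hN0 : 0 < N := Finset.prod_pos fun x _ => Finset.prod_pos fun i _ => (c x i).den_pos
  have hNQ : (N : ℚ) ≠ 0 := by exact_mod_cast hN0.ne'
  refine ⟨ι, inferInstance, fun i => (N : ℚ)⁻¹ • e i, fun i => ?_, ?_, fun x hx => ?_⟩
  · simp only [Rat.smul_def]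
    have := he i
    push_cast
    positivity
  · have := hind.units_smul fun _ => Units.mk0 _ (inv_ne_zero hNQ)
    exact this
  · have hmem : x ∈ AddSubmonoid.closure (range fun i => (N : ℚ)⁻¹ • e i) := by
      rw [hc x hx]
      refine sum_mem fun i _ => ?_
      obtain ⟨d, hd⟩ : (c x i).den ∣ N :=
        (Finset.dvd_prod_of_mem (fun i => (c x i).den) (Finset.mem_univ i)).trans
          (Finset.dvd_prod_of_mem (fun x => ∏ i, (c x i).den) hx)
      have : c x i • e i = ((c x i).num.toNat * d) • ((N : ℚ)⁻¹ • e i) := by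
        rw [← Nat.cast_smul_eq_nsmul ℚ, smul_smul]
        congr 1
        have h1 : (((c x i).num.toNat : ℕ) : ℚ) = (c x i).num := by
          exact_mod_cast Int.toNat_of_nonneg (Rat.num_nonneg.2 (hc0 x hx i))
        rw [Nat.cast_mul, h1, ← div_eq_mul_inv, eq_div_iff hNQ]
        rw [← Rat.mul_den_eq_num (c x i)]
        rw [hd]
        push_cast
        ring
      rw [this]
      exact AddSubmonoid.nsmul_mem _ (AddSubmonoid.subset_closure (mem_range_self i)) _
    exact exists_sum_of_mem_closure hmem

/-! ### Equal invariants give a dissection. -/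

theorem exists_Ico_partition {M : ℕ} (w : Fin M → ℝ) (hw : ∀ k, 0 < w k) (l : ℝ) :
    ∃ z : Fin M → ℝ, (⋃ k, Ico (z k) (z k + w k)) = Ico l (l + ∑ k, w k) ∧
      Pairwise fun i j => Disjoint (Ico (z i) (z i + w i)) (Ico (z j) (z j + w j)) := by
  induction M generalizing l with
  | zero => exact ⟨Fin.elim0, by simp, fun i => i.elim0⟩
  | succ M ih =>
    obtain ⟨z, hz, hd⟩ := ih (fun k => w k.succ) (fun k => hw _) (l + w 0)
    have hs : 0 ≤ ∑ k : Fin M, w k.succ := Finset.sum_nonneg fun k _ => (hw _).le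
    refine ⟨Fin.cons l z, ?_, ?_⟩
    · rw [Fin.sum_univ_succ, ← add_assoc,
        ← Ico_union_Ico_eq_Ico (b := l + w 0) (by linarith [hw 0]) (by linarith), ← hz]
      ext x
      simp [Fin.exists_fin_succ]
    · have h0 : ∀ j : Fin M, Disjoint (Ico l (l + w 0)) (Ico (z j) (z j + w j.succ)) := by
        intro j
        rw [Set.disjoint_left]
        intro x hx hx'
        have : x ∈ Ico (l + w 0) (l + w 0 + ∑ k : Fin M, w k.succ) := hz ▸ mem_iUnion.2 ⟨j, hx'⟩
        exact absurd hx.2 (not_lt.2 this.1)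
      intro i j
      refine Fin.cases ?_ (fun i => ?_) i <;> refine Fin.cases ?_ (fun j => ?_) j <;> intro hij
      · exact absurd rfl hij
      · simpa using h0 j
      · simpa using (h0 i).symm
      · simpa using hd fun h => hij (congrArg _ h)

theorem exists_rect_partition {M N : ℕ} (w : Fin M → ℝ) (h : Fin N → ℝ) (hw : ∀ k, 0 < w k)
    (hh : ∀ k, 0 < h k) (hw' : 0 < ∑ k, w k) (hh' : 0 < ∑ k, h k) (l b : ℝ) :
    ∃ z : Fin N × Fin M → ℝ × ℝ, Subdivides
      (fun k => Icc (z k).1 ((z k).1 + w k.2) ×ˢ Icc (z k).2 ((z k).2 + h k.1))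
      (Icc l (l + ∑ k, w k) ×ˢ Icc b (b + ∑ k, h k)) := by
  obtain ⟨x, hx, hdx⟩ := exists_Ico_partition w hw l
  obtain ⟨y, hy, hdy⟩ := exists_Ico_partition h hh b
  have close : ∀ {M : ℕ} (w : Fin M → ℝ) (_ : ∀ k, 0 < w k) (l : ℝ) (x : Fin M → ℝ)
      (_ : (⋃ k, Ico (x k) (x k + w k)) = Ico l (l + ∑ k, w k)) (_ : 0 < ∑ k, w k),
      (⋃ k, Icc (x k) (x k + w k)) = Icc l (l + ∑ k, w k) := by
    intro M w hw l x hx hs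
    rw [← closure_Ico (by linarith : l ≠ _), ← hx, closure_iUnion_of_finite]
    exact iUnion_congr fun k => (closure_Ico (lt_add_of_pos_right _ (hw k)).ne).symm
  refine ⟨fun k => (x k.2, y k.1), ?_, ?_⟩
  · rw [← close w hw l x hx hw', ← close h hh b y hy hh']
    ext z
    simp only [mem_iUnion, mem_prod, Prod.exists]
    constructor
    · rintro ⟨j, i, h1, h2⟩
      exact ⟨⟨i, h1⟩, j, h2⟩
    · rintro ⟨⟨i, h1⟩, j, h2⟩
      exact ⟨j, i, h1, h2⟩
  · rintro ⟨j, i⟩ ⟨j', i'⟩ hne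
    simp only [interior_prod_eq, interior_Icc]
    rw [Set.disjoint_prod]
    by_cases hi : i = i'
    · have hj : j ≠ j' := fun hj => hne (by rw [hi, hj])
      exact Or.inr ((hdy hj).mono Ioo_subset_Ico_self Ioo_subset_Ico_self)
    · exact Or.inl ((hdx hi).mono Ioo_subset_Ico_self Ioo_subset_Ico_self)

/-- A family of sets cut into rectangles can be cut into rectangles whose side lengths are
members of a family `e`, if the side lengths of the rectangles are sums of members of `e`. -/
theorem exists_cells {α ι J : Type} [Fintype ι] {A : α → Set (ℝ × ℝ)} {a : ι → α}
    {l r b t : ι → ℝ} (hlr : ∀ i, l i < r i) (hbt : ∀ i, b i < t i)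
    (hA : ∀ x, Subdivides (fun k : {k // a k = x} => Icc (l k) (r k) ×ˢ Icc (b k) (t k)) (A x))
    {e : J → ℝ} (he : ∀ j, 0 < e j)
    (hw : ∀ i, ∃ (M : ℕ) (τ : Fin M → J), r i - l i = ∑ k, e (τ k))
    (hh : ∀ i, ∃ (M : ℕ) (τ : Fin M → J), t i - b i = ∑ k, e (τ k)) :
    ∃ (K : Type) (_ : Fintype K) (τ : K → J × J) (z : K → ℝ × ℝ) (a' : K → α),
      (∀ x, Subdivides (fun k : {k // a' k = x} => Icc (z k).1 ((z k).1 + e (τ k).2) ×ˢ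
        Icc (z k).2 ((z k).2 + e (τ k).1)) (A x)) ∧
      ∑ i, (t i - b i) ⊗ₜ[ℚ] (r i - l i) = ∑ k, e (τ k).1 ⊗ₜ[ℚ] e (τ k).2 := by
  choose M τ hτ using hw
  choose N σ hσ using hh
  have hcell : ∀ i, ∃ z : Fin (N i) × Fin (M i) → ℝ × ℝ, Subdivides
      (fun k => Icc (z k).1 ((z k).1 + e (τ i k.2)) ×ˢ Icc (z k).2 ((z k).2 + e (σ i k.1)))
      (Icc (l i) (r i) ×ˢ Icc (b i) (t i)) := by
    intro i
    have h1 := hlr i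
    have h2 := hbt i
    have := exists_rect_partition (fun k => e (τ i k)) (fun k => e (σ i k)) (fun _ => he _)
      (fun _ => he _) (by rw [← hτ]; linarith) (by rw [← hσ]; linarith) (l i) (b i)
    rwa [← hτ, ← hσ, add_sub_cancel, add_sub_cancel] at this
  choose z hz using hcell
  refine ⟨Σ i, Fin (N i) × Fin (M i), inferInstance, fun k => (σ k.1 k.2.1, τ k.1 k.2.2),
    fun k => z k.1 k.2, fun k => a k.1, fun x => ⟨?_, ?_⟩, ?_⟩
  · rw [← (hA x).1]
    ext w
    simp only [mem_iUnion, Subtype.exists, Sigma.exists]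
    constructor
    · rintro ⟨i, k, hi, hw⟩
      exact ⟨i, hi, (hz i).1 ▸ mem_iUnion.2 ⟨k, hw⟩⟩
    · rintro ⟨i, hi, hw⟩
      rw [← (hz i).1] at hw
      obtain ⟨k, hk⟩ := mem_iUnion.1 hw
      exact ⟨i, k, hi, hk⟩
  · rintro ⟨⟨i, k⟩, hi⟩ ⟨⟨j, k'⟩, hj⟩ hne
    by_cases hij : i = j
    · subst hij
      exact (hz i).2 fun h => hne (Subtype.ext (congrArg (Sigma.mk i) h))
    · refine ((hA x).2 (i := ⟨i, hi⟩) (j := ⟨j, hj⟩) fun h => hij (Subtype.mk.inj h)).mono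
        (interior_mono ?_) (interior_mono ?_)
      · exact (subset_iUnion_of_subset k subset_rfl).trans (hz i).1.le
      · exact (subset_iUnion_of_subset k' subset_rfl).trans (hz j).1.le
  · rw [Fintype.sum_sigma]
    refine Finset.sum_congr rfl fun i _ => ?_
    rw [Fintype.sum_prod_type, hτ, hσ, TensorProduct.sum_tmul]
    simp_rw [TensorProduct.tmul_sum]

/-- Collecting equal terms, the coefficient of `v j` is the size of the fibre over `j`. Independence
equates the fibre sizes, and bijections of fibres glue. -/
theorem exists_equiv_of_sum_eq {K K' J V : Type*} [Fintype K] [Fintype K'] [Fintype J]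
    [AddCommGroup V] [Module ℚ V] {v : J → V} (hv : LinearIndependent ℚ v) {τ : K → J}
    {τ' : K' → J} (h : ∑ k, v (τ k) = ∑ k, v (τ' k)) : ∃ σ : K ≃ K', ∀ k, τ' (σ k) = τ k := by
  classical
  have hs : ∀ {K : Type _} [Fintype K] (τ : K → J),
      ∑ k, v (τ k) = ∑ j, (Fintype.card {k // τ k = j} : ℚ) • v j := by
    intro K _ τ
    rw [← Finset.sum_fiberwise (s := Finset.univ) (g := τ)]
    refine Finset.sum_congr rfl fun j _ => ?_
    rw [Finset.sum_congr rfl (g := fun _ => v j) fun k hk => by rw [(Finset.mem_filter.1 hk).2],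
      Finset.sum_const, Fintype.card_subtype, Nat.cast_smul_eq_nsmul]
  have hs' : ∑ k, v (τ' k) = ∑ j, (Fintype.card {k // τ' k = j} : ℚ) • v j := by
    rw [← Finset.sum_fiberwise (s := Finset.univ) (g := τ')]
    refine Finset.sum_congr rfl fun j _ => ?_
    rw [Finset.sum_congr rfl (g := fun _ => v j) fun k hk => by rw [(Finset.mem_filter.1 hk).2],
      Finset.sum_const, Fintype.card_subtype, Nat.cast_smul_eq_nsmul]
  rw [hs, hs', ← sub_eq_zero, ← Finset.sum_sub_distrib] at h
  simp_rw [← sub_smul] at h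
  have h0 := Fintype.linearIndependent_iff.1 hv _ h
  have hcard : ∀ j, Fintype.card {k // τ k = j} = Fintype.card {k // τ' k = j} := fun j => by
    exact_mod_cast sub_eq_zero.1 (h0 j)
  exact ⟨Equiv.ofFiberEquiv fun j => Fintype.equivOfCardEq (hcard j), Equiv.ofFiberEquiv_map _⟩

theorem Subdivides.of_equiv {ι κ : Type*} {f : ι → Set (ℝ × ℝ)} {g : κ → Set (ℝ × ℝ)}
    {A : Set (ℝ × ℝ)} (h : Subdivides f A) (σ : κ ≃ ι) (hg : ∀ k, g k = f (σ k)) :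
    Subdivides g A := by
  obtain rfl : g = f ∘ σ := funext hg
  exact ⟨by rw [← h.1]; exact σ.surjective.iUnion_comp f, h.2.comp_of_injective σ.injective⟩

theorem planeTranslate_rect (v : ℝ × ℝ) (l r b t : ℝ) :
    planeTranslate v (Icc l r ×ˢ Icc b t) = Icc (v.1 + l) (v.1 + r) ×ˢ Icc (v.2 + b) (v.2 + t) := by
  have : (fun x : ℝ × ℝ => v + x) = Prod.map (fun x => v.1 + x) (fun x => v.2 + x) := rfl
  rw [planeTranslate, this, prodMap_image_prod, image_const_add_Icc, image_const_add_Icc]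

/-- Families cut into rectangles with the same sum of tensors have an orthogonal dissection to each
other. -/
theorem hasOrthogonalDissection_of_sum_eq {α β ι κ : Type} [Fintype ι] [Fintype κ]
    {A : α → Set (ℝ × ℝ)} {B : β → Set (ℝ × ℝ)} {a : ι → α} {a' : κ → β}
    {l r b t : ι → ℝ} {l' r' b' t' : κ → ℝ} (hlr : ∀ i, l i < r i) (hbt : ∀ i, b i < t i)
    (hA : ∀ x, Subdivides (fun k : {k // a k = x} => Icc (l k) (r k) ×ˢ Icc (b k) (t k)) (A x))
    (hlr' : ∀ i, l' i < r' i) (hbt' : ∀ i, b' i < t' i)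
    (hB : ∀ x, Subdivides (fun k : {k // a' k = x} => Icc (l' k) (r' k) ×ˢ Icc (b' k) (t' k)) (B x))
    (hsum : ∑ i, (t i - b i) ⊗ₜ[ℚ] (r i - l i) = ∑ i, (t' i - b' i) ⊗ₜ[ℚ] (r' i - l' i)) :
    HasOrthogonalDissection A B := by
  classical
  obtain ⟨J, _, e, he, hind, hgen⟩ := exists_independent_generators
    ((Finset.univ.image (fun i => r i - l i) ∪ Finset.univ.image (fun i => t i - b i)) ∪
      (Finset.univ.image (fun i => r' i - l' i) ∪ Finset.univ.image (fun i => t' i - b' i))) (by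
    intro x hx
    simp only [Finset.mem_union, Finset.mem_image, Finset.mem_univ, true_and] at hx
    rcases hx with (⟨i, rfl⟩ | ⟨i, rfl⟩) | ⟨i, rfl⟩ | ⟨i, rfl⟩
    · exact sub_pos.2 (hlr i)
    · exact sub_pos.2 (hbt i)
    · exact sub_pos.2 (hlr' i)
    · exact sub_pos.2 (hbt' i))
  obtain ⟨K, _, τ, z, c, hc, hK⟩ := exists_cells hlr hbt hA he
    (fun i => hgen _ (by simp)) (fun i => hgen _ (by simp))
  obtain ⟨K', _, τ', z', c', hc', hK'⟩ := exists_cells hlr' hbt' hB he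
    (fun i => hgen _ (by simp)) (fun i => hgen _ (by simp))
  -- The tensors `e i ⊗ e j` are independent because `e` is, so the cells of the two families match
  -- in shape.
  obtain ⟨σ, hσ⟩ := exists_equiv_of_sum_eq (hind.tmul_of_flat_left hind) (τ := τ) (τ' := τ')
    (by rw [← hK, ← hK', hsum])
  let φ : Fin (Fintype.card K) ≃ K := (Fintype.equivFin K).symm
  refine ⟨Fintype.card K, fun k => Icc (z (φ k)).1 ((z (φ k)).1 + e (τ (φ k)).2) ×ˢ
    Icc (z (φ k)).2 ((z (φ k)).2 + e (τ (φ k)).1), fun k => c (φ k), fun k => c' (σ (φ k)),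
    fun k => z' (σ (φ k)) - z (φ k), fun k => ?_, fun x => ?_, fun y => ?_⟩
  · exact isOrthogonalPolygon_rect (lt_add_of_pos_right _ (he _)) (lt_add_of_pos_right _ (he _))
  · exact (hc x).of_equiv (φ.subtypeEquiv fun k => Iff.rfl) fun k => rfl
  · refine (hc' y).of_equiv ((φ.trans σ).subtypeEquiv fun k => Iff.rfl) fun k => ?_
    rw [planeTranslate_rect]
    simp only [Prod.fst_sub, Prod.snd_sub, sub_add_cancel, ← add_assoc]
    rw [← hσ]
    rfl

/-! ### Translates, packings and fundamental regions. -/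

theorem mem_planeTranslate {v z : ℝ × ℝ} {A : Set (ℝ × ℝ)} :
    z ∈ planeTranslate v A ↔ z - v ∈ A := by
  constructor
  · rintro ⟨w, hw, rfl⟩
    simpa using hw
  · intro h
    exact ⟨z - v, h, by simp⟩

theorem closure_planeTranslate (v : ℝ × ℝ) (A : Set (ℝ × ℝ)) :
    closure (planeTranslate v A) = planeTranslate v (closure A) :=
  ((Homeomorph.addLeft v).image_closure A).symm

open scoped Pointwise in
theorem isBounded_planeTranslate (v : ℝ × ℝ) {A : Set (ℝ × ℝ)} (h : Bornology.IsBounded A) :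
    Bornology.IsBounded (planeTranslate v A) := by
  have : planeTranslate v A = ({v} : Set (ℝ × ℝ)) + A := by rw [singleton_add]; rfl
  rw [this]
  exact Bornology.isBounded_singleton.add h

theorem planeTranslate_mem_dehnGraph {E : Set (ℝ × ℝ)} {d : ℝ ⊗[ℚ] ℝ}
    (h : (E.indicator 1, d) ∈ dehnGraph) (v : ℝ × ℝ) :
    ((planeTranslate v E).indicator 1, d) ∈ dehnGraph := by
  convert dehnGraph_translate h v using 2
  ext z
  by_cases hz : z - v ∈ E
  · simp [hz, mem_planeTranslate]
  · simp [hz, mem_planeTranslate]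

theorem inter_mem_dehnGraph {E E' : Set (ℝ × ℝ)} {d d' : ℝ ⊗[ℚ] ℝ}
    (h : (E.indicator 1, d) ∈ dehnGraph) (h' : (E'.indicator 1, d') ∈ dehnGraph) :
    ∃ d'', ((E ∩ E').indicator 1, d'') ∈ dehnGraph := by
  have := dehnGraph_mul h h'
  rwa [← inter_indicator_one] at this

/-- In a packing by translates of a set with nonempty interior, finitely many translation vectors
lie in a bounded set. -/
theorem finite_inter_of_disjoint_translates {T S B : Set (ℝ × ℝ)} (hT : (interior T).Nonempty)
    (hS : ∀ s ∈ S, ∀ s' ∈ S, s ≠ s' →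
      Disjoint (interior (planeTranslate s T)) (interior (planeTranslate s' T)))
    (hB : Bornology.IsBounded B) : (S ∩ B).Finite := by
  obtain ⟨w, hw⟩ := hT
  obtain ⟨ε, hε, hb⟩ := Metric.isOpen_iff.1 isOpen_interior w hw
  have hsub : ∀ s, Metric.ball (s + w) ε ⊆ interior (planeTranslate s T) := by
    intro s
    refine interior_maximal (fun z hz => mem_planeTranslate.2 (interior_subset (hb ?_)))
      Metric.isOpen_ball
    rw [mem_ball_iff_norm] at hz ⊢
    rwa [sub_sub]
  -- Disjoint balls of equal positive volume inside a bounded set are finite in number.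
  have key := MeasureTheory.Measure.finite_const_le_meas_of_disjoint_iUnion
    (MeasureTheory.volume : MeasureTheory.Measure (ℝ × ℝ))
    (As := fun s : (S ∩ B : Set (ℝ × ℝ)) => Metric.ball ((s : ℝ × ℝ) + w) ε)
    (ε := MeasureTheory.volume (Metric.ball w ε)) (Metric.measure_ball_pos _ _ hε)
    (fun _ => measurableSet_ball)
    (fun s s' h => (hS _ s.2.1 _ s'.2.1 fun h' => h (Subtype.ext h')).mono (hsub _) (hsub _)) (by
      refine (Bornology.IsBounded.measure_lt_top ?_).ne
      refine ((hB.add (Bornology.isBounded_singleton (x := w))).add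
        (Metric.isBounded_ball (x := (0 : ℝ × ℝ)) (r := ε))).subset (iUnion_subset fun s => ?_)
      intro z hz
      refine ⟨s + w, ⟨s, s.2.2, w, rfl, rfl⟩, z - (s + w), ?_, by simp⟩
      rw [mem_ball_iff_norm] at hz
      simpa using hz)
  have huniv : {s : (S ∩ B : Set (ℝ × ℝ)) | MeasureTheory.volume (Metric.ball w ε) ≤
      MeasureTheory.volume (Metric.ball ((s : ℝ × ℝ) + w) ε)} = univ := by
    refine eq_univ_of_forall fun s => ?_
    rw [mem_ofPred_eq, MeasureTheory.Measure.addHaar_ball_center,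
      MeasureTheory.Measure.addHaar_ball_center _ (_ + _)]
  rw [huniv] at key
  exact finite_coe_iff.1 (finite_univ_iff.1 key)

theorem finite_translates_meeting {T S B : Set (ℝ × ℝ)} (hT : (interior T).Nonempty)
    (hTb : Bornology.IsBounded T)
    (hS : ∀ s ∈ S, ∀ s' ∈ S, s ≠ s' →
      Disjoint (interior (planeTranslate s T)) (interior (planeTranslate s' T)))
    (hB : Bornology.IsBounded B) : {s ∈ S | (planeTranslate s T ∩ B).Nonempty}.Finite := by
  refine (finite_inter_of_disjoint_translates hT hS (hB.sub hTb)).subset ?_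
  rintro s ⟨hs, z, hz, hzB⟩
  exact ⟨hs, z, hzB, z - s, mem_planeTranslate.1 hz, by simp⟩

/-- `R` contains exactly one point of every coset of `L`. -/
def IsFundamentalRegion (L : AddSubgroup (ℝ × ℝ)) (R : Set (ℝ × ℝ)) : Prop :=
  ∀ z, ∃ x ∈ L, z - x ∈ R ∧ ∀ y ∈ L, z - y ∈ R → y = x

theorem IsFundamentalRegion.disjoint {L : AddSubgroup (ℝ × ℝ)} {R : Set (ℝ × ℝ)}
    (h : IsFundamentalRegion L R) {x y : ℝ × ℝ} (hx : x ∈ L) (hy : y ∈ L) (hxy : x ≠ y) :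
    Disjoint (planeTranslate x R) (planeTranslate y R) := by
  rw [Set.disjoint_left]
  intro z hz hz'
  rw [mem_planeTranslate] at hz hz'
  obtain ⟨w, _, _, hw⟩ := h z
  exact hxy ((hw x hx hz).trans (hw y hy hz').symm)

theorem IsElementaryCore.planeTranslate {E T : Set (ℝ × ℝ)} {d : ℝ ⊗[ℚ] ℝ}
    (h : IsElementaryCore E T d) (v : ℝ × ℝ) :
    IsElementaryCore (planeTranslate v E) (planeTranslate v T) d :=
  ⟨planeTranslate_mem_dehnGraph h.mem v, by rw [closure_planeTranslate, h.closure_eq],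
    isBounded_planeTranslate v h.bounded⟩

theorem IsElementaryCore.interior_nonempty {E T : Set (ℝ × ℝ)} {d : ℝ ⊗[ℚ] ℝ}
    (h : IsElementaryCore E T d) (hE : E.Nonempty) : (interior T).Nonempty := by
  obtain ⟨z, hz⟩ := hE
  obtain ⟨w, hw⟩ := (h.stable.eventually_interior hz).exists
  exact ⟨w, interior_mono (h.closure_eq ▸ subset_closure) hw⟩

theorem IsElementaryCore.disjoint_iff {E T E' T' : Set (ℝ × ℝ)} {d d' : ℝ ⊗[ℚ] ℝ}
    (h : IsElementaryCore E T d) (h' : IsElementaryCore E' T' d') :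
    Disjoint (interior T) (interior T') ↔ Disjoint E E' := by
  rw [← h.closure_eq, ← h'.closure_eq]
  exact ⟨h.stable.disjoint_of_disjoint_interior h'.stable, h'.stable.disjoint_interior_closure⟩

theorem tilesPlanePeriodically_of_isFundamentalRegion {u v : ℝ × ℝ} {R T : Set (ℝ × ℝ)}
    {d : ℝ ⊗[ℚ] ℝ} (huv : LinearIndependent ℝ ![u, v]) (hR : IsElementaryCore R T d)
    (h : IsFundamentalRegion (AddSubgroup.closure {u, v}) R) : TilesPlanePeriodically T := by
  have trans : ∀ x ∈ AddSubgroup.closure {u, v}, planeTranslate x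
      (AddSubgroup.closure {u, v} : Set (ℝ × ℝ)) = AddSubgroup.closure {u, v} := by
    intro x hx
    ext z
    rw [mem_planeTranslate]
    exact ⟨fun h => by simpa using add_mem h hx, fun h => sub_mem h hx⟩
  refine ⟨AddSubgroup.closure {u, v}, ⟨?_, fun s s' hs => ?_⟩, u, v, huv,
    trans u (AddSubgroup.subset_closure (by simp)), trans v (AddSubgroup.subset_closure (by simp))⟩
  · refine eq_univ_of_forall fun z => ?_
    obtain ⟨x, hx, hz, _⟩ := h z
    refine mem_iUnion.2 ⟨⟨x, hx⟩, mem_planeTranslate.2 ?_⟩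
    exact hR.closure_eq ▸ subset_closure hz
  · exact ((hR.planeTranslate s).disjoint_iff (hR.planeTranslate s')).2
      (h.disjoint s.2 s'.2 fun h => hs (Subtype.ext h))

/-- The Dehn invariant of a fundamental region of a lattice is a multiple of the Dehn invariant of
the prototile of a tiling invariant under the lattice. -/
theorem exists_dehn_fundamentalRegion_eq_nsmul {E T R R' S : Set (ℝ × ℝ)} {d dR : ℝ ⊗[ℚ] ℝ}
    {L : AddSubgroup (ℝ × ℝ)} (hE : IsElementaryCore E T d) (hEn : E.Nonempty)
    (hR : IsElementaryCore R R' dR) (hL : IsFundamentalRegion L R)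
    (hS : Subdivides (fun s : S => planeTranslate s T) univ)
    (hLS : ∀ x ∈ L, ∀ s, s ∈ S ↔ s + x ∈ S) : ∃ k : ℕ, 0 < k ∧ dR = k • d := by
  classical
  have hRn : R.Nonempty := by
    obtain ⟨x, _, hx, _⟩ := hL 0
    exact ⟨_, hx⟩
  have hSd : ∀ s ∈ S, ∀ s' ∈ S, s ≠ s' →
      Disjoint (interior (planeTranslate s T)) (interior (planeTranslate s' T)) :=
    fun s hs s' hs' h => hS.2 (i := ⟨s, hs⟩) (j := ⟨s', hs'⟩) fun h' => h (Subtype.mk.inj h')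
  have hSd' : ∀ s ∈ S, ∀ s' ∈ S, s ≠ s' → Disjoint (planeTranslate s E) (planeTranslate s' E) :=
    fun s hs s' hs' h =>
      ((hE.planeTranslate s).disjoint_iff (hE.planeTranslate s')).1 (hSd s hs s' hs' h)
  have hTb : Bornology.IsBounded T := hE.closure_eq ▸ hE.bounded.closure
  have hTn := hE.interior_nonempty hEn
  have hcover : ∀ z, ∃ s ∈ S, z ∈ planeTranslate s E := by
    intro z
    obtain ⟨s, hs, hz⟩ := exists_mem_of_eventually_mem_closure
      (finite_translates_meeting hTn hTb hSd (Metric.isBounded_ball (x := z) (r := 1)))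
      (E := fun s => planeTranslate s E) (fun s _ => (hE.planeTranslate s).stable) (z := z) (by
        filter_upwards [nhds_le_quadrantFilter (Metric.ball_mem_nhds z one_pos)] with w hw
        obtain ⟨s, hs⟩ := mem_iUnion.1 (hS.1.symm ▸ mem_univ w)
        exact ⟨s, ⟨s.2, w, hs, hw⟩, (hE.planeTranslate s).closure_eq ▸ hs⟩)
    exact ⟨s, hs.1, hz⟩
  -- `S ∩ R` represents the orbits of `S` under `L`; its size is the multiplier `k`.
  have hS0 : (S ∩ R).Finite := finite_inter_of_disjoint_translates hTn hSd hR.bounded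
  have hL0 : {x ∈ (L : Set (ℝ × ℝ)) | (planeTranslate x R' ∩
      ⋃ s ∈ S ∩ R, planeTranslate s E).Nonempty}.Finite := by
    refine finite_translates_meeting (hR.interior_nonempty hRn)
      (hR.closure_eq ▸ hR.bounded.closure) (fun x hx y hy hxy =>
        ((hR.planeTranslate x).disjoint_iff (hR.planeTranslate y)).2 (hL.disjoint hx hy hxy)) ?_
    exact (Bornology.isBounded_biUnion hS0).2 fun s _ => isBounded_planeTranslate s hE.bounded
  set S0 := S ∩ R with hS0def
  set L0 := {x ∈ (L : Set (ℝ × ℝ)) | (planeTranslate x R' ∩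
      ⋃ s ∈ S0, planeTranslate s E).Nonempty} with hL0def
  have := hS0.fintype
  have := hL0.fintype
  have hmemL0 : ∀ x ∈ L, ∀ s ∈ S0, ∀ z, z - x ∈ R → z - s ∈ E → x ∈ L0 := by
    intro x hx s hs z hz hz'
    refine ⟨hx, z, mem_planeTranslate.2 (hR.closure_eq ▸ subset_closure hz), ?_⟩
    exact mem_iUnion₂.2 ⟨s, hs, mem_planeTranslate.2 hz'⟩
  have hpiece : ∀ (s : S0) (x : L0), ∃ d', ((planeTranslate x R ∩ planeTranslate s E).indicator 1,
      d') ∈ dehnGraph := fun s x =>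
    inter_mem_dehnGraph (hR.planeTranslate x).mem (hE.planeTranslate s).mem
  choose δ hδ using hpiece
  -- The translates `x + R` cut each representative tile `s + E` into the pieces `δ s x`.
  have h1 : ∀ s : S0, d = ∑ x, δ s x := by
    intro s
    refine dehnGraph_unique (hE.planeTranslate s).mem
      (sum_mem_dehnGraph_of_partition ?_ (fun x y hxy => ?_) (hδ s))
    · ext z
      simp only [mem_iUnion, mem_inter_iff, exists_and_right, and_iff_right_iff_imp]
      intro hz
      obtain ⟨x, hx, hzx, _⟩ := hL z
      exact ⟨⟨x, hmemL0 x hx s s.2 z hzx (mem_planeTranslate.1 hz)⟩, mem_planeTranslate.2 hzx⟩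
    · exact (hL.disjoint x.2.1 y.2.1 fun h => hxy (Subtype.ext h)).mono inter_subset_left
        inter_subset_left
  have hpt : ∀ (s : S0) (x : L0) (z : ℝ × ℝ),
      z ∈ planeTranslate (-(x : ℝ × ℝ)) (planeTranslate x R ∩ planeTranslate s E) ↔
        z ∈ R ∧ z ∈ planeTranslate (s - x) E := by
    intro s x z
    simp only [mem_planeTranslate, mem_inter_iff, sub_neg_eq_add, add_sub_cancel_right]
    rw [show z + x - s = z - (s - x : ℝ × ℝ) by abel]
  have hSx : ∀ (s : S0) (x : L0), (s - x : ℝ × ℝ) ∈ S := fun s x => by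
    rw [hLS x x.2.1, sub_add_cancel]
    exact s.2.1
  -- Moved by `-x`, the pieces become `R ∩ (s - x + E)`. They partition `R` because each vector of
  -- `S` is `s - x` for a unique representative `s` and lattice vector `x`.
  have h2 : dR = ∑ k : S0 × L0, δ k.1 k.2 := by
    refine dehnGraph_unique hR.mem (sum_mem_dehnGraph_of_partition ?_ (fun k k' hkk => ?_)
      fun k => planeTranslate_mem_dehnGraph (hδ k.1 k.2) (-(k.2 : ℝ × ℝ)))
    · ext z
      simp only [mem_iUnion, hpt, Prod.exists, exists_and_left, and_iff_left_iff_imp]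
      intro hz
      obtain ⟨s, hs, hzs⟩ := hcover z
      obtain ⟨x, hx, hsx, _⟩ := hL s
      have hs0 : s - x ∈ S0 := by
        refine ⟨?_, hsx⟩
        rw [hLS x hx, sub_add_cancel]
        exact hs
      rw [mem_planeTranslate] at hzs
      refine ⟨⟨_, hs0⟩, ⟨-x, hmemL0 _ (L.neg_mem hx) _ hs0 (z - x) (by simpa using hz)
        (by simpa using hzs)⟩, ?_⟩
      simpa [mem_planeTranslate] using hzs
    · refine Set.disjoint_left.2 fun z hz hz' => ?_
      rw [hpt] at hz hz'
      apply hkk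
      have heq : (k.1 - k.2 : ℝ × ℝ) = k'.1 - k'.2 := by
        by_contra hne
        exact Set.disjoint_left.1 (hSd' _ (hSx _ _) _ (hSx _ _) hne) hz.2 hz'.2
      obtain ⟨w, _, _, hw⟩ := hL (k.1 - k.2)
      have e1 := hw (-k.2) (L.neg_mem k.2.2.1) (by simpa using k.1.2.2)
      have e2 := hw (-k'.2) (L.neg_mem k'.2.2.1) (by rw [heq]; simpa using k'.1.2.2)
      have e3 : (k.2 : ℝ × ℝ) = k'.2 := neg_injective (e1.trans e2.symm)
      refine Prod.ext (Subtype.ext ?_) (Subtype.ext e3)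
      rw [e3] at heq
      exact sub_left_injective heq
  refine ⟨Fintype.card S0, ?_, ?_⟩
  · obtain ⟨s, hs, _⟩ := hcover 0
    obtain ⟨x, hx, hsx, _⟩ := hL s
    refine Fintype.card_pos_iff.2 ⟨⟨s - x, ?_, hsx⟩⟩
    rw [hLS x hx, sub_add_cancel]
    exact hs
  · rw [h2, Fintype.sum_prod_type]
    simp_rw [← h1]
    simp

/-! ### The L-shape as a fundamental region, and the lattices it serves. -/

/-- The half-open L-shape with arms `c × (d + b)` and `a × d` (width times height). -/
def lRegion (a b c d : ℝ) : Set (ℝ × ℝ) := hoRect 0 c 0 (d + b) ∪ hoRect 0 a 0 d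

/-- On a vertical line at `x`, for each `n` exactly one `m` gives a tile of index `m • (a, -b) + n •
(c, d)` meeting the line. That tile occupies the heights from `g n` to `g (n + 1)`, and these
intervals partition the line. -/
theorem isFundamentalRegion_lRegion {a b c d : ℝ} (hb : 0 < b) (hc : 0 < c) (hca : c ≤ a)
    (hd : 0 < d) :
    IsFundamentalRegion (AddSubgroup.closure {(a, -b), (c, d)}) (lRegion a b c d) := by
  have ha : 0 < a := hc.trans_le hca
  rintro ⟨x, y⟩
  set g : ℤ → ℝ := fun n => n * d - ⌊(x - n * c) / a⌋ * b with hg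
  have hmono : ∀ n n' : ℤ, n ≤ n' → g n + (n' - n) * d ≤ g n' := by
    intro n n' h
    have : (⌊(x - n' * c) / a⌋ : ℝ) ≤ ⌊(x - n * c) / a⌋ := by
      have : (n : ℝ) ≤ n' := by exact_mod_cast h
      exact_mod_cast Int.floor_le_floor (by gcongr)
    have := mul_le_mul_of_nonneg_right this hb.le
    simp only [hg]
    linarith
  have hiff : ∀ m n : ℤ, ((x, y) - (m • (a, -b) + n • (c, d)) : ℝ × ℝ) ∈ lRegion a b c d ↔
      m = ⌊(x - n * c) / a⌋ ∧ g n ≤ y ∧ y < g (n + 1) := by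
    intro m n
    have hz : ((x, y) - (m • (a, -b) + n • (c, d)) : ℝ × ℝ) =
        (x - m * a - n * c, y + m * b - n * d) := by
      ext <;> simp <;> ring
    rw [hz]
    have hfl : ∀ n k : ℤ, k = ⌊(x - n * c) / a⌋ ↔ 0 ≤ x - k * a - n * c ∧ x - k * a - n * c < a := by
      intro n k
      rw [eq_comm, Int.floor_eq_iff, le_div_iff₀ ha, div_lt_iff₀ ha, add_mul, one_mul]
      constructor <;> rintro ⟨h1, h2⟩ <;> constructor <;> linarith
    have hgn : m = ⌊(x - n * c) / a⌋ → g n = n * d - m * b := fun h => by simp only [hg, ← h]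
    -- Passing to `n + 1` lowers the floor by one exactly over the tall arm; `c ≤ a` prevents a
    -- larger drop. The increment of `g` is thus the height of the tile over `x`.
    have hgn1 : m = ⌊(x - n * c) / a⌋ → (x - m * a - n * c < c → g (n + 1) = n * d - m * b + d + b) ∧
        (c ≤ x - m * a - n * c → g (n + 1) = n * d - m * b + d) := by
      intro h
      rw [hfl] at h
      constructor <;> intro h'
      · have := (hfl (n + 1) (m - 1)).2 (by push_cast; constructor <;> linarith)
        simp only [hg, ← this]
        push_cast; ring
      · have := (hfl (n + 1) m).2 (by push_cast; constructor <;> linarith)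
        simp only [hg, ← this]
        push_cast; ring
    simp only [lRegion, mem_union, mem_hoRect]
    constructor
    · intro h
      have hm : m = ⌊(x - n * c) / a⌋ := by
        rw [hfl]
        rcases h with h | h
        · exact ⟨h.1.1, h.1.2.trans_le hca⟩
        · exact h.1
      rw [hgn hm]
      refine ⟨hm, by rcases h with h | h <;> linarith [h.2.1], ?_⟩
      rcases lt_or_ge (x - m * a - n * c) c with h' | h'
      · rw [(hgn1 hm).1 h']
        rcases h with h | h <;> linarith [h.2.2]
      · rw [(hgn1 hm).2 h']
        rcases h with h | h <;> linarith [h.2.2, h.1.2]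
    · rintro ⟨hm, h1, h2⟩
      rw [hgn hm] at h1
      have h3 := (hfl n m).1 hm
      rcases lt_or_ge (x - m * a - n * c) c with h' | h'
      · rw [(hgn1 hm).1 h'] at h2
        exact Or.inl ⟨⟨h3.1, h'⟩, by linarith, by linarith⟩
      · rw [(hgn1 hm).2 h'] at h2
        exact Or.inr ⟨h3, by linarith, by linarith⟩
  obtain ⟨n, hn, hmax⟩ := Int.exists_greatest_of_bdd (P := fun n => g n ≤ y)
    ⟨max 0 ⌈(y - g 0) / d⌉, fun n hn => by
      rcases le_or_gt n 0 with h | h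
      · exact le_max_of_le_left h
      · refine le_max_of_le_right ?_
        have := hmono 0 n h.le
        have h1 : (n : ℝ) ≤ (y - g 0) / d := by
          rw [le_div_iff₀ hd]; push_cast at this; linarith
        exact_mod_cast h1.trans (Int.le_ceil _)⟩
    ⟨min 0 ⌊(y - g 0) / d⌋, by
      have h0 := hmono (min 0 ⌊(y - g 0) / d⌋) 0 (min_le_left _ _)
      have h1 : ((min 0 ⌊(y - g 0) / d⌋ : ℤ) : ℝ) ≤ (y - g 0) / d :=
        (by exact_mod_cast min_le_right _ _ : ((min 0 ⌊(y - g 0) / d⌋ : ℤ) : ℝ) ≤ ⌊(y - g 0) / d⌋).trans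
          (Int.floor_le _)
      rw [le_div_iff₀ hd] at h1
      rw [Int.cast_zero] at h0
      linarith⟩
  have hn' : y < g (n + 1) := by
    by_contra! h
    have := hmax _ h
    omega
  refine ⟨_, AddSubgroup.mem_closure_pair.2 ⟨⌊(x - n * c) / a⌋, n, rfl⟩, (hiff _ _).2 ⟨rfl, hn, hn'⟩,
    ?_⟩
  intro w hw hw'
  obtain ⟨m', n', rfl⟩ := AddSubgroup.mem_closure_pair.1 hw
  obtain ⟨h1, h2, h3⟩ := (hiff _ _).1 hw'
  have hnn : n' = n := by
    rcases lt_trichotomy n' n with h | h | h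
    · exfalso
      have := hmono (n' + 1) n h
      have e : (0 : ℝ) ≤ (n - (n' + 1 : ℤ)) * d :=
        mul_nonneg (sub_nonneg.2 (by exact_mod_cast h)) hd.le
      linarith
    · exact h
    · exact absurd (hmax _ h2) (not_le.2 h)
  rw [h1, hnn]

theorem isElementaryCore_lRegion {a b c d : ℝ} (hb : 0 < b) (hc : 0 < c) (hca : c ≤ a)
    (hd : 0 < d) :
    IsElementaryCore (lRegion a b c d) (Icc 0 c ×ˢ Icc 0 (d + b) ∪ Icc 0 a ×ˢ Icc 0 d)
      (d ⊗ₜ[ℚ] a + b ⊗ₜ[ℚ] c) := by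
  have ha : 0 < a := hc.trans_le hca
  refine ⟨?_, ?_, ?_⟩
  · have h1 := hoRect_mem_dehnGraph ha.le hd.le
    have h2 := hoRect_mem_dehnGraph hc.le (by linarith : d ≤ d + b)
    have := dehnGraph.add_mem h1 h2
    rw [Prod.mk_add_mk, sub_zero, sub_zero, sub_zero, add_sub_cancel_left,
      show (hoRect 0 a 0 d).indicator (1 : ℝ × ℝ → ℤ) + (hoRect 0 c d (d + b)).indicator 1 =
        fun z => (hoRect 0 a 0 d).indicator 1 z + (hoRect 0 c d (d + b)).indicator 1 z from rfl,
      ← indicator_union_of_disjoint] at this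
    · have hset : lRegion a b c d = hoRect 0 a 0 d ∪ hoRect 0 c d (d + b) := ?_
      · rwa [hset]
      ext z
      simp only [lRegion, mem_union, mem_hoRect]
      constructor
      · rintro (h | h)
        · rcases lt_or_ge z.2 d with h' | h'
          · exact Or.inl ⟨⟨h.1.1, by linarith [h.1.2]⟩, h.2.1, h'⟩
          · exact Or.inr ⟨h.1, h', h.2.2⟩
        · exact Or.inl h
      · rintro (h | h)
        · exact Or.inr h
        · exact Or.inl ⟨h.1, by linarith [h.2.1], h.2.2⟩
    · rw [Set.disjoint_left]
      intro z hz hz'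
      exact absurd hz.2.2 (not_lt.2 hz'.2.1)
  · rw [lRegion, closure_union, closure_hoRect hc (by linarith), closure_hoRect ha hd]
  · exact ((Metric.isBounded_Ico _ _).prod (Metric.isBounded_Ico _ _)).union
      ((Metric.isBounded_Ico _ _).prod (Metric.isBounded_Ico _ _))

theorem exists_mem_lattice_near {u v : ℝ × ℝ} (huv : LinearIndependent ℝ ![u, v]) :
    ∃ C : ℝ, ∀ w : ℝ × ℝ, ∃ x ∈ AddSubgroup.closure {u, v},
      |x.1 - w.1| ≤ C ∧ |x.2 - w.2| ≤ C := by
  refine ⟨|u.1| + |v.1| + (|u.2| + |v.2|), fun w => ?_⟩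
  have hsp := huv.span_eq_top_of_card_eq_finrank (by simp)
  have hw : w ∈ Submodule.span ℝ (range ![u, v]) := hsp ▸ Submodule.mem_top
  obtain ⟨α, rfl⟩ := (Submodule.mem_span_range_iff_exists_fun ℝ).1 hw
  refine ⟨_, AddSubgroup.mem_closure_pair.2 ⟨⌊α 0⌋, ⌊α 1⌋, rfl⟩, ?_⟩
  have key : ∀ α β s t : ℝ, |⌊α⌋ * s + ⌊β⌋ * t - (α * s + β * t)| ≤ |s| + |t| := by
    intro α β s t
    have h : ∀ α : ℝ, |⌊α⌋ - α| ≤ 1 := fun α => by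
      rw [abs_le]
      constructor <;> linarith [Int.floor_le α, Int.lt_floor_add_one α]
    calc |⌊α⌋ * s + ⌊β⌋ * t - (α * s + β * t)| = |(⌊α⌋ - α) * s + (⌊β⌋ - β) * t| := by ring_nf
      _ ≤ |(⌊α⌋ - α) * s| + |(⌊β⌋ - β) * t| := abs_add_le _ _
      _ ≤ |s| + |t| := by
        rw [abs_mul, abs_mul]
        gcongr
        · exact mul_le_of_le_one_left (abs_nonneg _) (h _)
        · exact mul_le_of_le_one_left (abs_nonneg _) (h _)
  have h1 := key (α 0) (α 1) u.1 v.1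
  have h2 := key (α 0) (α 1) u.2 v.2
  have := abs_nonneg u.1
  have := abs_nonneg v.1
  have := abs_nonneg u.2
  have := abs_nonneg v.2
  simp only [Fin.sum_univ_two, Prod.fst_add, Prod.snd_add, Prod.smul_fst, Prod.smul_snd,
    smul_eq_mul, Matrix.cons_val_zero, Matrix.cons_val_one]
  simp only [zsmul_eq_mul]
  constructor <;> linarith

/-- Every lattice contains a pair of vectors generating a lattice with an L-shaped fundamental
region. -/
theorem exists_lRegion_basis {u v : ℝ × ℝ} (huv : LinearIndependent ℝ ![u, v]) :
    ∃ a b c d : ℝ, 0 < b ∧ 0 < c ∧ c ≤ a ∧ 0 < d ∧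
      AddSubgroup.closure {(a, -b), (c, d)} ≤ AddSubgroup.closure {u, v} := by
  obtain ⟨C, hC⟩ := exists_mem_lattice_near huv
  -- With error at most `C`, both coordinates of `q` are at least `1` and `q.1 ≤ 2 * C + 1 ≤ p.1`,
  -- while `p.2 ≤ -1`.
  obtain ⟨q, hq, hq1, hq2⟩ := hC (C + 1, C + 1)
  obtain ⟨p, hp, hp1, hp2⟩ := hC (3 * C + 1, -(C + 1))
  rw [abs_le] at hq1 hq2 hp1 hp2
  simp only at hq1 hq2 hp1 hp2
  refine ⟨p.1, -p.2, q.1, q.2, by linarith, by linarith, by linarith, by linarith, ?_⟩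
  rw [AddSubgroup.closure_le, neg_neg]
  rintro z (rfl | rfl)
  · exact hp
  · exact hq

theorem mem_iff_add_mem_of_translate_eq {u v : ℝ × ℝ} {S : Set (ℝ × ℝ)} (hu : planeTranslate u S = S)
    (hv : planeTranslate v S = S) {x : ℝ × ℝ} (hx : x ∈ AddSubgroup.closure {u, v}) :
    ∀ s, s ∈ S ↔ s + x ∈ S := by
  have base : ∀ u : ℝ × ℝ, planeTranslate u S = S → ∀ s, s ∈ S ↔ s + u ∈ S := by
    intro u hu s
    conv_rhs => rw [← hu, mem_planeTranslate, add_sub_cancel_right]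
  induction hx using AddSubgroup.closure_induction with
  | mem x h =>
    rcases h with rfl | rfl
    · exact base _ hu
    · exact base _ hv
  | zero => simp
  | add x y _ _ hx hy =>
    intro s
    rw [hx s, hy, add_assoc]
  | neg x _ hx =>
    intro s
    rw [hx (s + -x), neg_add_cancel_right]

/-- The Dehn invariant of a prototile of a periodic tiling is a sum of two pure tensors, up to a
positive integral multiple. -/
theorem TilesPlanePeriodically.exists_nsmul_eq {E T : Set (ℝ × ℝ)} {d : ℝ ⊗[ℚ] ℝ}
    (hT : TilesPlanePeriodically T) (hE : IsElementaryCore E T d) (hEn : E.Nonempty) :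
    ∃ (k : ℕ) (x₁ y₁ x₂ y₂ : ℝ), 0 < k ∧ k • d = x₁ ⊗ₜ[ℚ] y₁ + x₂ ⊗ₜ[ℚ] y₂ := by
  obtain ⟨S, hS, u, v, huv, hu, hv⟩ := hT
  obtain ⟨a, b, c, e, hb, hc, hca, he, hle⟩ := exists_lRegion_basis huv
  obtain ⟨k, hk, h⟩ := exists_dehn_fundamentalRegion_eq_nsmul hE hEn
    (isElementaryCore_lRegion hb hc hca he) (isFundamentalRegion_lRegion hb hc hca he) hS
    fun x hx => mem_iff_add_mem_of_translate_eq hu hv (hle hx)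
  exact ⟨k, _, _, _, _, hk, h.symm⟩

/-! ### Tensors of rank at most two and positivity. -/

theorem exists_eq_sum_tmul (D : ℝ ⊗[ℚ] ℝ) :
    ∃ (r : ℕ) (x y : Fin r → ℝ), D = ∑ i, x i ⊗ₜ[ℚ] y i := by
  induction D using TensorProduct.induction_on with
  | zero => exact ⟨0, Fin.elim0, Fin.elim0, by simp⟩
  | tmul x y => exact ⟨1, fun _ => x, fun _ => y, by simp⟩
  | add D D' h h' =>
    obtain ⟨r, x, y, rfl⟩ := h
    obtain ⟨r', x', y', rfl⟩ := h'
    exact ⟨r + r', Fin.append x x', Fin.append y y', by simp [Fin.sum_univ_add]⟩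

theorem tensorRank_le_two_iff {D : ℝ ⊗[ℚ] ℝ} :
    tensorRank D ≤ 2 ↔ ∃ x₁ y₁ x₂ y₂ : ℝ, D = x₁ ⊗ₜ[ℚ] y₁ + x₂ ⊗ₜ[ℚ] y₂ := by
  constructor
  · intro h
    -- Nonemptiness makes the infimum attained, which excludes the default value `0` of `sInf ∅`.
    obtain ⟨x, y, hD⟩ := Nat.sInf_mem (exists_eq_sum_tmul D)
    change tensorRank D ≤ 2 at h
    change D = ∑ i : Fin (tensorRank D), x i ⊗ₜ[ℚ] y i at hD
    change Fin (tensorRank D) → ℝ at x y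
    generalize tensorRank D = r at h x y
    interval_cases r
    · exact ⟨0, 0, 0, 0, by simpa using hD⟩
    · exact ⟨x 0, y 0, 0, 0, by simpa using hD⟩
    · exact ⟨x 0, y 0, x 1, y 1, by simpa [Fin.sum_univ_two] using hD⟩
  · rintro ⟨x₁, y₁, x₂, y₂, rfl⟩
    exact Nat.sInf_le ⟨![x₁, x₂], ![y₁, y₂], by simp [Fin.sum_univ_two]⟩

theorem exists_pos_decomposition_of_pos {x₁ y₁ x₂ y₂ : ℝ} (hx : 0 < x₁) (hy : 0 < y₁)
    (h : 0 < x₁ * y₁ + x₂ * y₂) : ∃ d a b c : ℝ, 0 < d ∧ 0 < a ∧ 0 < b ∧ 0 < c ∧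
      x₁ ⊗ₜ[ℚ] y₁ + x₂ ⊗ₜ[ℚ] y₂ = d ⊗ₜ[ℚ] a + b ⊗ₜ[ℚ] c := by
  have core : ∀ u y : ℝ, 0 < u → u * y < x₁ * y₁ → ∃ d a b c : ℝ, 0 < d ∧ 0 < a ∧ 0 < b ∧ 0 < c ∧
      x₁ ⊗ₜ[ℚ] y₁ + (-u) ⊗ₜ[ℚ] y = d ⊗ₜ[ℚ] a + b ⊗ₜ[ℚ] c := by
    -- For rational `r`, `x₁ ⊗ y₁ - u ⊗ y = (x₁ - r • u) ⊗ y₁ + u ⊗ (r • y₁ - y)`. All factors are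
    -- positive when `y / y₁ < r < x₁ / u`, and positive area leaves room for such an `r`.
    intro u y hu h
    obtain ⟨r, hr1, hr2⟩ := exists_rat_btwn (show y / y₁ < x₁ / u by
      rw [div_lt_div_iff₀ hy hu]; linarith)
    rw [div_lt_iff₀ hy] at hr1
    rw [lt_div_iff₀ hu] at hr2
    refine ⟨x₁ - r • u, y₁, u, r • y₁ - y, ?_, hy, hu, ?_, ?_⟩
    · rw [Rat.smul_def]; linarith
    · rw [Rat.smul_def]; linarith
    · rw [TensorProduct.sub_tmul, TensorProduct.tmul_sub, TensorProduct.neg_tmul,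
        TensorProduct.smul_tmul]
      abel
  rcases lt_trichotomy x₂ 0 with h2 | h2 | h2
  · have := core (-x₂) y₂ (by linarith) (by linarith)
    rwa [neg_neg] at this
  · refine ⟨x₁ / 2, y₁, x₁ / 2, y₁, half_pos hx, hy, half_pos hx, hy, ?_⟩
    rw [← TensorProduct.add_tmul, add_halves, h2, TensorProduct.zero_tmul, add_zero]
  · have := core x₂ (-y₂) h2 (by linarith)
    rwa [TensorProduct.neg_tmul, TensorProduct.tmul_neg, neg_neg] at this

theorem exists_pos_decomposition {x₁ y₁ x₂ y₂ : ℝ} (h : 0 < x₁ * y₁ + x₂ * y₂) :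
    ∃ d a b c : ℝ, 0 < d ∧ 0 < b ∧ 0 < c ∧ c ≤ a ∧
      x₁ ⊗ₜ[ℚ] y₁ + x₂ ⊗ₜ[ℚ] y₂ = d ⊗ₜ[ℚ] a + b ⊗ₜ[ℚ] c := by
  have signed : ∀ x₁ y₁ x₂ y₂ : ℝ, 0 < x₁ * y₁ + x₂ * y₂ → 0 < x₁ * y₁ →
      ∃ d a b c : ℝ, 0 < d ∧ 0 < a ∧ 0 < b ∧ 0 < c ∧
      x₁ ⊗ₜ[ℚ] y₁ + x₂ ⊗ₜ[ℚ] y₂ = d ⊗ₜ[ℚ] a + b ⊗ₜ[ℚ] c := by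
    intro x₁ y₁ x₂ y₂ h h1
    rcases pos_and_pos_or_neg_and_neg_of_mul_pos h1 with ⟨hx, hy⟩ | ⟨hx, hy⟩
    · exact exists_pos_decomposition_of_pos hx hy h
    · have := exists_pos_decomposition_of_pos (x₂ := x₂) (y₂ := y₂) (neg_pos.2 hx) (neg_pos.2 hy)
        (by rwa [neg_mul_neg])
      rwa [TensorProduct.neg_tmul, TensorProduct.tmul_neg, neg_neg] at this
  obtain ⟨d, a, b, c, hd, ha, hb, hc, hD⟩ : ∃ d a b c : ℝ, 0 < d ∧ 0 < a ∧ 0 < b ∧ 0 < c ∧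
      x₁ ⊗ₜ[ℚ] y₁ + x₂ ⊗ₜ[ℚ] y₂ = d ⊗ₜ[ℚ] a + b ⊗ₜ[ℚ] c := by
    rcases lt_or_ge 0 (x₁ * y₁) with h1 | h1
    · exact signed _ _ _ _ h h1
    · rw [add_comm]
      exact signed _ _ _ _ (by linarith) (by linarith)
  rcases le_total c a with hca | hca
  · exact ⟨d, a, b, c, hd, hb, hc, hca, hD⟩
  · exact ⟨b, c, d, a, hb, hd, ha, hca, by rw [hD, add_comm]⟩

/-! ### Area, invariance under dissection, and the theorem. -/

theorem IsDehnValue.area_pos {P : Set (ℝ × ℝ)} {D : ℝ ⊗[ℚ] ℝ} (h : IsDehnValue P D)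
    (hP : P.Nonempty) : 0 < LinearMap.mul' ℚ ℝ D := by
  obtain ⟨m, l, r, b, t, hlr, hbt, ⟨hU, _⟩, rfl⟩ := h
  obtain ⟨z, hz⟩ := hP
  obtain ⟨i, _⟩ := mem_iUnion.1 (hU.symm ▸ hz)
  rw [map_sum]
  refine Finset.sum_pos (fun i _ => ?_) ⟨i, Finset.mem_univ i⟩
  rw [LinearMap.mul'_apply]
  exact mul_pos (sub_pos.2 (hbt i)) (sub_pos.2 (hlr i))

/-- A stable set is determined by its closure, so the union of the cores of the pieces is the core
of the whole, and the cores are disjoint. Additivity on partitions then applies. -/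
theorem IsElementaryCore.eq_sum {ι : Type*} [Fintype ι] {E p : ι → Set (ℝ × ℝ)}
    {d : ι → ℝ ⊗[ℚ] ℝ} {F A : Set (ℝ × ℝ)} {D : ℝ ⊗[ℚ] ℝ}
    (hp : ∀ i, IsElementaryCore (E i) (p i) (d i)) (hA : IsElementaryCore F A D)
    (h : Subdivides p A) : D = ∑ i, d i := by
  have hst : QuadrantStable (⋃ i, E i) := QuadrantStable.iUnion fun i => (hp i).stable
  have hcl : closure (⋃ i, E i) = closure F := by
    rw [closure_iUnion_of_finite, hA.closure_eq, ← h.1]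
    exact iUnion_congr fun i => (hp i).closure_eq
  have heq : (⋃ i, E i) = F := Subset.antisymm (hst.subset_of_closure_subset hA.stable hcl.le)
    (hA.stable.subset_of_closure_subset hst hcl.ge)
  exact dehnGraph_unique hA.mem (sum_mem_dehnGraph_of_partition heq
    (fun i j hij => ((hp i).disjoint_iff (hp j)).1 (h.2 hij)) fun i => (hp i).mem)

theorem IsOrthogonalPolygon.nonempty {P : Set (ℝ × ℝ)} (hP : IsOrthogonalPolygon P) : P.Nonempty :=
  hP.connected.nonempty.mono interior_subset

theorem sum_sum_fiber {K α V : Type*} [Fintype K] [Fintype α] [DecidableEq α] [AddCommMonoid V]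
    (a : K → α) (f : K → V) : ∑ i, ∑ k : {k // a k = i}, f k = ∑ k, f k := by
  rw [← Fintype.sum_sigma (f := fun x : Σ i, {k // a k = i} => f x.2)]
  exact Fintype.sum_equiv (Equiv.sigmaFiberEquiv a) _ _ fun _ => rfl

/-- The Dehn invariant is invariant under orthogonal dissections. -/
theorem HasOrthogonalDissection.sum_eq {α β : Type*} [Fintype α] [Fintype β]
    {A F : α → Set (ℝ × ℝ)} {B G : β → Set (ℝ × ℝ)} {d : α → ℝ ⊗[ℚ] ℝ} {d' : β → ℝ ⊗[ℚ] ℝ}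
    (h : HasOrthogonalDissection A B) (hA : ∀ i, IsElementaryCore (F i) (A i) (d i))
    (hB : ∀ j, IsElementaryCore (G j) (B j) (d' j)) : ∑ i, d i = ∑ j, d' j := by
  classical
  obtain ⟨m, p, a, b, v, hp, h1, h2⟩ := h
  choose E hE using fun k => (dehnInvariant_spec (hp k)).exists_core
  have e1 : ∀ i, d i = ∑ k : {k // a k = i}, dehnInvariant (p k) := fun i =>
    IsElementaryCore.eq_sum (fun k : {k // a k = i} => hE k) (hA i) (h1 i)
  have e2 : ∀ j, d' j = ∑ k : {k // b k = j}, dehnInvariant (p k) := fun j =>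
    IsElementaryCore.eq_sum (fun k : {k // b k = j} => (hE k).planeTranslate (v k)) (hB j) (h2 j)
  simp_rw [e1, e2]
  rw [sum_sum_fiber a (fun k => dehnInvariant (p k)), sum_sum_fiber b (fun k => dehnInvariant (p k))]

theorem linearIndependent_lBasis {a b c d : ℝ} (hb : 0 < b) (hc : 0 < c) (hca : c ≤ a)
    (hd : 0 < d) : LinearIndependent ℝ ![((a, -b) : ℝ × ℝ), (c, d)] := by
  rw [LinearIndependent.pair_iff]
  intro s t h
  have h1 := congrArg Prod.fst h
  have h2 := congrArg Prod.snd h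
  simp at h1 h2
  have ha : 0 < a := hc.trans_le hca
  have hdet : 0 < a * d + b * c := by positivity
  have hs : s * (a * d + b * c) = 0 := by linear_combination d * h1 - c * h2
  have ht : t * (a * d + b * c) = 0 := by linear_combination b * h1 + a * h2
  exact ⟨(mul_eq_zero.1 hs).resolve_right hdet.ne', (mul_eq_zero.1 ht).resolve_right hdet.ne'⟩

theorem hasOrthogonalDissection_L {P : Set (ℝ × ℝ)} {D : ℝ ⊗[ℚ] ℝ} (hP : IsDehnValue P D) {n : ℕ}
    {a b c d : ℝ} (hb : 0 < b) (hc : 0 < c) (hca : c ≤ a) (hd : 0 < d)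
    (hD : n • D = d ⊗ₜ[ℚ] a + b ⊗ₜ[ℚ] c) :
    HasOrthogonalDissection (fun _ : Fin n => P)
      (fun _ : Unit => Icc 0 c ×ˢ Icc 0 (d + b) ∪ Icc 0 a ×ˢ Icc 0 d) := by
  obtain ⟨m, l, r, u, t, hlr, hut, hsub, rfl⟩ := hP
  have ha : 0 < a := hc.trans_le hca
  -- `true` is the lower bar `[0, a] × [0, d]`, `false` the block `[0, c] × [d, d + b]` on top of
  -- it.
  refine hasOrthogonalDissection_of_sum_eq (ι := Fin n × Fin m) (κ := Bool) (a := Prod.fst)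
    (a' := fun _ => ()) (l := fun k => l k.2) (r := fun k => r k.2) (b := fun k => u k.2)
    (t := fun k => t k.2) (l' := fun _ => 0) (r' := fun k => cond k a c)
    (b' := fun k => cond k 0 d) (t' := fun k => cond k d (d + b)) (fun k => hlr _)
    (fun k => hut _) (fun x => ?_) ?_ ?_ (fun _ => ⟨?_, ?_⟩) ?_
  · exact hsub.of_equiv ⟨fun k => k.1.2, fun j => ⟨(x, j), rfl⟩,
      fun ⟨⟨_, _⟩, h⟩ => by subst h; rfl, fun _ => rfl⟩ fun _ => rfl
  · rintro (_ | _) <;> assumption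
  · rintro (_ | _)
    · simpa using hb
    · exact hd
  · ext z
    simp only [mem_iUnion, Subtype.exists, Bool.exists_bool, cond_true, cond_false, mem_union,
      mem_prod, mem_Icc, exists_const]
    constructor
    · rintro (h | h)
      · exact Or.inl ⟨h.1, hd.le.trans h.2.1, h.2.2⟩
      · exact Or.inr h
    · rintro (h | h)
      · rcases le_total z.2 d with h' | h'
        · exact Or.inr ⟨⟨h.1.1, h.1.2.trans hca⟩, h.2.1, h'⟩
        · exact Or.inl ⟨h.1, h', h.2.2⟩
      · exact Or.inr h
  · have hdisj : Disjoint (interior (Icc 0 c ×ˢ Icc d (d + b)))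
        (interior (Icc 0 a ×ˢ Icc 0 d)) := by
      simp only [interior_prod_eq, interior_Icc]
      refine Set.disjoint_left.2 fun z hz hz' => ?_
      exact absurd hz.2.1 (not_lt.2 hz'.2.2.le)
    rintro ⟨_ | _, _⟩ ⟨_ | _, _⟩ h
    · exact absurd rfl h
    · exact hdisj
    · exact hdisj.symm
    · exact absurd rfl h
  · simp only [Fintype.sum_prod_type]
    rw [Finset.sum_const, Finset.card_univ, Fintype.card_fin, hD]
    simp

theorem mainTheorem5 (P : Set (ℝ × ℝ)) (hP : IsOrthogonalPolygon P) (n : ℕ) (hn : 1 ≤ n) :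
    (∃ T : Set (ℝ × ℝ), IsOrthogonalPolygon T ∧ TilesPlanePeriodically T ∧
      HasOrthogonalDissection (fun _ : Fin n => P) (fun _ : Unit => T)) ↔
    tensorRank (dehnInvariant P) ≤ 2 := by
  have hD := dehnInvariant_spec hP
  rw [tensorRank_le_two_iff]
  constructor
  · rintro ⟨T, hT, htile, hdis⟩
    obtain ⟨E, hE⟩ := hD.exists_core
    obtain ⟨F, hF⟩ := (dehnInvariant_spec hT).exists_core
    have hFn : F.Nonempty := closure_nonempty_iff.1 (hF.closure_eq ▸ hT.nonempty)
    obtain ⟨k, x₁, y₁, x₂, y₂, hk, hk'⟩ := htile.exists_nsmul_eq hF hFn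
    have hsum := hdis.sum_eq (fun _ => hE) (fun _ => hF)
    rw [Finset.sum_const, Finset.card_univ, Fintype.card_fin, Fintype.sum_unique] at hsum
    rw [← hsum, smul_smul, ← Nat.cast_smul_eq_nsmul ℚ] at hk'
    have hkn : ((k * n : ℕ) : ℚ) ≠ 0 := by
      exact_mod_cast (Nat.mul_pos hk hn).ne'
    refine ⟨((k * n : ℕ) : ℚ)⁻¹ • x₁, y₁, ((k * n : ℕ) : ℚ)⁻¹ • x₂, y₂, ?_⟩
    rw [← TensorProduct.smul_tmul', ← TensorProduct.smul_tmul', ← smul_add, ← hk',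
      inv_smul_smul₀ hkn]
  · rintro ⟨x₁, y₁, x₂, y₂, h⟩
    have hpos := hD.area_pos hP.nonempty
    rw [h, map_add, LinearMap.mul'_apply, LinearMap.mul'_apply] at hpos
    obtain ⟨d, a, b, c, hd, hb, hc, hca, h'⟩ := exists_pos_decomposition hpos
    have hn' : (0 : ℝ) < n := by exact_mod_cast hn
    -- The factor `n` goes into the heights only, so `c ≤ a` is preserved.
    have hd' : 0 < (n : ℝ) * d := mul_pos hn' hd
    have hb' : 0 < (n : ℝ) * b := mul_pos hn' hb
    refine ⟨_, isOrthogonalPolygon_L hc hca hd' (lt_add_of_pos_right _ hb'),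
      tilesPlanePeriodically_of_isFundamentalRegion (linearIndependent_lBasis hb' hc hca hd')
        (isElementaryCore_lRegion hb' hc hca hd') (isFundamentalRegion_lRegion hb' hc hca hd'),
      hasOrthogonalDissection_L hD hb' hc hca hd' ?_⟩
    rw [h, h', smul_add, TensorProduct.smul_tmul', TensorProduct.smul_tmul', nsmul_eq_mul,
      nsmul_eq_mul]
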